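/- There exists a finitely generated torsion-free group $\Gamma$ of intermediate growth whose center $Z(\Gamma)$ is isomorphic to $\mathbb{Z}^{\infty}=\bigoplus_{n\in\mathbb{N}}\mathbb{Z}$, the direct sum of countably infinitely many copies of $\mathbb{Z}$. Here, for a finite generating set $S$ of a group $G$, $v_{G,S}(n)$ is the number of elements of $G$ at distance at most $n$ from the identity in the Cayley graph of $(G,S)$, and a finitely generated group $G$ is of intermediate growth if, for every finite generating set $S$, $\lim_{n\to\infty}v_{G,S}(n)^{1/n}=1$ while there are no constants $C,d>0$ with $v_{G,S}(n)\le Cn^{d}$ for all $n\ge 1$. -/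

import Mathlib

open Filter Topology

/-- The growth function `v_{G,S}(n)`: the number of elements of `G` at graph distance at most `n`
from the identity in the Cayley graph of `(G, S)`. For finite `S` this ball is finite. -/
noncomputable def growthFunction {G : Type*} [Group G] (S : Finset G) (n : ℕ) : ℕ :=
  Set.ncard {g : G | (SimpleGraph.mulCayley (S : Set G)).edist 1 g ≤ (n : ℕ∞)}

/-- `v` is bounded by a polynomial: `v n ≤ C * n ^ d` for all `n ≥ 1`
(at `n = 0` the right-hand side vanishes while a growth function is `1`). -/
def PolynomiallyBounded (v : ℕ → ℕ) : Prop :=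
  ∃ d : ℝ, 0 < d ∧ ∃ C : ℝ, 0 < C ∧ ∀ n : ℕ, 1 ≤ n → (v n : ℝ) ≤ C * (n : ℝ) ^ d

/-- `v` is sub-exponential: `v n ^ (1 / n) → 1`. -/
def Subexponential (v : ℕ → ℕ) : Prop :=
  Tendsto (fun n : ℕ => (v n : ℝ) ^ (1 / (n : ℝ))) atTop (𝓝 1)

/-- A finitely generated group is of intermediate growth if its growth function with respect to
every finite generating set is sub-exponential but not bounded by a polynomial. -/
def IntermediateGrowth (G : Type*) [Group G] : Prop :=
  Group.FG G ∧ ∀ S : Finset G, Subgroup.closure (S : Set G) = ⊤ →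
    Subexponential (growthFunction S) ∧ ¬ PolynomiallyBounded (growthFunction S)

/-- A group is torsion-free if the identity is its only element of finite order. -/
def TorsionFreeGroup (G : Type*) [Group G] : Prop :=
  ∀ g : G, IsOfFinOrder g → g = 1

/-! The group is a torsion-free relative of the Grigorchuk group. An element has two sections and a
shift in ℤ, whose parity permutes the two subtrees; the parity classes (1,0), (0,1), (1,1) of
directed letters play the roles of b, c, d. A directed letter also carries two lamp exponents. Lamps
of different kinds in different subtrees commute only up to a central term, and the area at a vertex
records the pairs that separate there.

Growth: for suitable weights, the two sections of an alternating word cost together at most 6/7 of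
the word, up to a constant (`cost_secWord`, `Alternating.sum_le`). Sections, shift and area
determine an element, and the last two are polynomially bounded, so iteration gives subexponential
growth (`ncard_cheap_le`). Shortening of sections also yields `section_induction`, hence
torsion-freeness.

Centre: a central element has even shift and two equal, central sections, so `Center.down` is an
endomorphism, and each element is killed by some power of it. Charges of central elements vanish, so
area is additive on them, and the shifts and areas of all levels embed the centre in a free abelian
group: it is free. Commutators of lamps, copied diagonally down the tree, show that no single power
of `Center.down` vanishes, so the rank is infinite. This also excludes polynomial growth. -/

namespace IntermediateCenter

/-! ### Letters and the wreath recursion with Heisenberg cocycle -/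

/-- The abelian group of directed letters: the first two coordinates are the exponents of the
directed automorphisms, the last two those of the two lamps. -/
abbrev Letter : Type := ℤ × ℤ × ℤ × ℤ

/-- The section of a directed letter at the vertex it is directed to. -/
def Letter.turn : Letter →+ Letter where
  toFun β := (-β.2.1, β.1 - β.2.1, β.2.2.1, β.2.2.2)
  map_zero' := by simp
  map_add' x y := by ext <;> simp <;> ring

/-- The exponent of the rooted generator in the other section of a directed letter. -/
def Letter.spin : Letter →+ ℤ where
  toFun β := β.1 - β.2.1
  map_zero' := by simp
  map_add' x y := by simp; ring

/-- The free product of the group of rooted letters and the group of directed letters. -/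
abbrev Pre : Type := Monoid.Coprod (Multiplicative ℤ) (Multiplicative Letter)

namespace Pre

/-- The rooted element with the given exponent. -/
def rot : Multiplicative ℤ →* Pre := Monoid.Coprod.inl

/-- The directed element given by a letter. -/
def dir : Multiplicative Letter →* Pre := Monoid.Coprod.inr

/-- The total exponent of the first lamp. -/
def charge : Pre →* Multiplicative ℤ :=
  Monoid.Coprod.lift 1
    { toFun := fun β => Multiplicative.ofAdd β.toAdd.2.2.1
      map_one' := rfl
      map_mul' := fun _ _ => rfl }

/-- The total exponent of the second lamp. -/
def cocharge : Pre →* Multiplicative ℤ :=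
  Monoid.Coprod.lift 1
    { toFun := fun β => Multiplicative.ofAdd β.toAdd.2.2.2
      map_one' := rfl
      map_mul' := fun _ _ => rfl }

end Pre

/-- The data of an element at the root of the tree: two sections, a shift whose parity is the
permutation of the two subtrees, and the contribution to the Heisenberg centre of the pairs of
lamps in different subtrees. -/
@[ext]
structure Wreath where
  /-- the two sections -/
  sec : ZMod 2 → Pre
  /-- the shift -/
  shift : ℤ
  /-- the Heisenberg cocycle -/
  area : ℤ

namespace Wreath

open Pre

instance : Mul Wreath where
  mul x y :=
    { sec := fun j => x.sec j * y.sec (j + x.shift)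
      shift := x.shift + y.shift
      area := x.area + y.area +
        ∑ j : ZMod 2, (charge (x.sec j)).toAdd * (cocharge (y.sec (j + 1 + x.shift))).toAdd }

instance : One Wreath where
  one := { sec := 1, shift := 0, area := 0 }

instance : Inv Wreath where
  inv x :=
    { sec := fun j => (x.sec (j - x.shift))⁻¹
      shift := -x.shift
      area := -x.area +
        ∑ j : ZMod 2, (charge (x.sec j)).toAdd * (cocharge (x.sec (j + 1))).toAdd }

theorem sec_mul (x y : Wreath) (j : ZMod 2) :
    (x * y).sec j = x.sec j * y.sec (j + x.shift) := rfl

theorem shift_mul (x y : Wreath) : (x * y).shift = x.shift + y.shift := rfl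

theorem area_mul (x y : Wreath) : (x * y).area = x.area + y.area +
    ∑ j : ZMod 2, (charge (x.sec j)).toAdd * (cocharge (y.sec (j + 1 + x.shift))).toAdd := rfl

theorem sec_one (j : ZMod 2) : (1 : Wreath).sec j = 1 := rfl

theorem shift_one : (1 : Wreath).shift = 0 := rfl

theorem area_one : (1 : Wreath).area = 0 := rfl

theorem sec_inv (x : Wreath) (j : ZMod 2) : x⁻¹.sec j = (x.sec (j - x.shift))⁻¹ := rfl

theorem shift_inv (x : Wreath) : x⁻¹.shift = -x.shift := rfl

theorem area_inv (x : Wreath) : x⁻¹.area = -x.area +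
    ∑ j : ZMod 2, (charge (x.sec j)).toAdd * (cocharge (x.sec (j + 1))).toAdd := rfl

theorem sum_shift (f : ZMod 2 → ℤ) (k : ZMod 2) : ∑ j : ZMod 2, f (j + k) = ∑ j : ZMod 2, f j :=
  Equiv.sum_comp (Equiv.addRight k) f

instance : Group Wreath := Group.ofLeftAxioms
  (by
    intro x y z
    ext j
    · simp [sec_mul, shift_mul, mul_assoc, add_assoc]
    · simp [shift_mul, add_assoc]
    -- The shift of x only permutes the subtrees, so the cross term of y and z can be reindexed by
    -- it.
    · have h := sum_shift (fun j => (charge (y.sec j)).toAdd *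
        (cocharge (z.sec (j + 1 + y.shift))).toAdd) x.shift
      simp only [area_mul, sec_mul, shift_mul, map_mul, toAdd_mul, add_mul, mul_add,
        Finset.sum_add_distrib, ← h, Int.cast_add]
      have e : ∀ j : ZMod 2, j + (x.shift : ZMod 2) + 1 + y.shift = j + 1 + (x.shift + y.shift) :=
        fun j => by ring
      have e' : ∀ j : ZMod 2, j + 1 + (x.shift : ZMod 2) + y.shift = j + 1 + (x.shift + y.shift) :=
        fun j => by ring
      simp only [e, e']
      ring)
  (by
    intro x
    ext j
    · simp [sec_mul, sec_one, shift_one]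
    · simp [shift_mul, shift_one]
    · simp [area_mul, sec_one, area_one])
  (by
    intro x
    ext j
    · simp only [sec_mul, sec_inv, sec_one, shift_inv, Int.cast_neg, ← sub_eq_add_neg,
        inv_mul_cancel]
    · simp [shift_mul, shift_inv, shift_one]
    · have h := sum_shift (fun j => (charge (x.sec j)).toAdd *
        (cocharge (x.sec (j + 1))).toAdd) (-x.shift)
      have e : ∀ j : ZMod 2, j + -(x.shift : ZMod 2) + 1 = j + 1 + -(x.shift : ZMod 2) :=
        fun j => by ring
      simp only [area_mul, area_inv, shift_inv, sec_inv, map_inv, toAdd_inv, neg_mul,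
        Finset.sum_neg_distrib, area_one, ← h, Int.cast_neg, sub_eq_add_neg, e]
      ring)

/-- Rooted elements. -/
def rot : Multiplicative ℤ →* Wreath where
  toFun i := { sec := 1, shift := i.toAdd, area := 0 }
  map_one' := rfl
  map_mul' x y := by
    ext j
    · simp [sec_mul]
    · simp [shift_mul]
    · simp [area_mul]

/-- Directed elements. -/
def dir : Multiplicative Letter →* Wreath where
  toFun β :=
    { sec := fun j => if j = 0 then Pre.rot (.ofAdd β.toAdd.spin) else Pre.dir (.ofAdd β.toAdd.turn)
      shift := 0
      area := 0 }
  map_one' := by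
    ext j
    · by_cases hj : j = 0 <;> simp [hj, sec_one]
    · rfl
    · rfl
  map_mul' x y := by
    ext j
    · by_cases hj : j = 0 <;> simp [hj, sec_mul]
    · simp [shift_mul]
    -- In every pair of different subtrees one section is rooted and carries no lamps, so the
    -- cocycle vanishes.
    · have h (i : Multiplicative ℤ) : Pre.charge (Pre.rot i) = 1 := rfl
      have h' (i : Multiplicative ℤ) : Pre.cocharge (Pre.rot i) = 1 := rfl
      have h2 : ∀ f : ZMod 2 → ℤ, ∑ j, f j = f 0 + f 1 := Fin.sum_univ_two
      have h11 : (1 + 1 : ZMod 2) = 0 := rfl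
      simp [area_mul, h2, h, h', h11]

end Wreath

namespace Pre

/-- The wreath recursion. -/
def wreath : Pre →* Wreath := Monoid.Coprod.lift Wreath.rot Wreath.dir

/-- A directed letter hands its lamps unchanged to the section it is directed to, rooted letters
have none, and multiplication only permutes sections. -/
theorem charge_eq_sum (w : Pre) :
    (charge w).toAdd = ∑ j : ZMod 2, (charge ((wreath w).sec j)).toAdd := by
  have h2 : ∀ f : ZMod 2 → ℤ, ∑ j, f j = f 0 + f 1 := Fin.sum_univ_two
  induction w using Monoid.Coprod.induction_on with
  | inl i => simp [wreath, Wreath.rot, charge]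
  | inr β => simp [wreath, Wreath.dir, charge, h2, rot, dir, Letter.turn]
  | mul x y hx hy =>
    have h := Wreath.sum_shift (fun j => (charge ((wreath y).sec j)).toAdd) (wreath x).shift
    simp only [map_mul, toAdd_mul, hx, hy, Wreath.sec_mul, Finset.sum_add_distrib, h]

theorem cocharge_eq_sum (w : Pre) :
    (cocharge w).toAdd = ∑ j : ZMod 2, (cocharge ((wreath w).sec j)).toAdd := by
  have h2 : ∀ f : ZMod 2 → ℤ, ∑ j, f j = f 0 + f 1 := Fin.sum_univ_two
  induction w using Monoid.Coprod.induction_on with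
  | inl i => simp [wreath, Wreath.rot, cocharge]
  | inr β => simp [wreath, Wreath.dir, cocharge, h2, rot, dir, Letter.turn]
  | mul x y hx hy =>
    have h := Wreath.sum_shift (fun j => (cocharge ((wreath y).sec j)).toAdd) (wreath x).shift
    simp only [map_mul, toAdd_mul, hx, hy, Wreath.sec_mul, Finset.sum_add_distrib, h]

/-! ### Agreement level by level -/

/-- Two elements agree up to level `n` of the tree. -/
def Agree : ℕ → Pre → Pre → Prop
  | 0, x, y => charge x = charge y ∧ cocharge x = cocharge y
  | n + 1, x, y => (wreath x).shift = (wreath y).shift ∧ (wreath x).area = (wreath y).area ∧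
      ∀ j, Agree n ((wreath x).sec j) ((wreath y).sec j)

theorem Agree.refl : ∀ (n : ℕ) (x : Pre), Agree n x x
  | 0, _ => ⟨rfl, rfl⟩
  | n + 1, _ => ⟨rfl, rfl, fun _ => Agree.refl n _⟩

theorem Agree.symm : ∀ {n : ℕ} {x y : Pre}, Agree n x y → Agree n y x
  | 0, _, _, h => ⟨h.1.symm, h.2.symm⟩
  | _ + 1, _, _, h => ⟨h.1.symm, h.2.1.symm, fun j => (h.2.2 j).symm⟩

theorem Agree.trans : ∀ {n : ℕ} {x y z : Pre}, Agree n x y → Agree n y z → Agree n x z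
  | 0, _, _, _, h, h' => ⟨h.1.trans h'.1, h.2.trans h'.2⟩
  | _ + 1, _, _, _, h, h' =>
    ⟨h.1.trans h'.1, h.2.1.trans h'.2.1, fun j => (h.2.2 j).trans (h'.2.2 j)⟩

/-- Equality of charges climbs up from the lowest level by summing over sections. The area of a
product involves charges of sections, so agreement is a congruence only because of this. -/
theorem Agree.charge_eq : ∀ {n : ℕ} {x y : Pre}, Agree n x y →
    charge x = charge y ∧ cocharge x = cocharge y
  | 0, _, _, h => h
  | n + 1, x, y, h => by
    have hj := fun j => (h.2.2 j).charge_eq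
    constructor
    · apply Multiplicative.toAdd.injective
      rw [charge_eq_sum, charge_eq_sum]
      simp only [(hj _).1]
    · apply Multiplicative.toAdd.injective
      rw [cocharge_eq_sum, cocharge_eq_sum]
      simp only [(hj _).2]

theorem Agree.mul : ∀ {n : ℕ} {x y x' y' : Pre}, Agree n x y → Agree n x' y' →
    Agree n (x * x') (y * y')
  | 0, _, _, _, _, h, h' => by simp [Agree, h.1, h.2, h'.1, h'.2]
  | n + 1, x, y, x', y', h, h' => by
    refine ⟨?_, ?_, fun j => ?_⟩
    · simp [Wreath.shift_mul, h.1, h'.1]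
    · simp only [map_mul, Wreath.area_mul, h.1, h.2.1, h'.2.1, (h.2.2 _).charge_eq.1,
        (h'.2.2 _).charge_eq.2]
    · simp only [map_mul, Wreath.sec_mul, h.1]
      exact (h.2.2 _).mul (h'.2.2 _)

/-- Agreement on the whole tree. -/
def agreeCon : Con Pre where
  r x y := ∀ n, Agree n x y
  iseqv := ⟨fun x n => .refl n x, fun h n => (h n).symm, fun h h' n => (h n).trans (h' n)⟩
  mul' h h' n := (h n).mul (h' n)

end Pre

/-! ### The group, its sections and its generators -/

/-- A torsion-free self-similar group: an extension of a torsion-free cover of the Grigorchuk group by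
a Heisenberg group of pairs of lamp configurations on an orbit of the boundary of the binary tree.
Elements are identified when their data agree at all vertices of the tree. -/
def Gam : Type := Pre.agreeCon.Quotient

namespace Gam

instance : Group Gam := inferInstanceAs (Group Pre.agreeCon.Quotient)

/-- The projection. -/
def mk : Pre →* Gam := Pre.agreeCon.mk'

theorem mk_surjective : Function.Surjective mk := Pre.agreeCon.mk'_surjective

theorem mk_eq {x y : Pre} : mk x = mk y ↔ ∀ n, Pre.Agree n x y := Pre.agreeCon.eq

/-- The section at a vertex of the first level. -/
def sec (j : ZMod 2) (g : Gam) : Gam :=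
  Con.liftOn g (fun w => mk ((Pre.wreath w).sec j)) fun _ _ h => mk_eq.2 fun n => (h (n + 1)).2.2 j

/-- The shift at the root. -/
def shift (g : Gam) : ℤ :=
  Con.liftOn g (fun w => (Pre.wreath w).shift) fun _ _ h => (h 1).1

/-- The Heisenberg cocycle at the root. -/
def area (g : Gam) : ℤ :=
  Con.liftOn g (fun w => (Pre.wreath w).area) fun _ _ h => (h 1).2.1

/-- The total exponent of the first lamp. -/
def charge (g : Gam) : ℤ :=
  Con.liftOn g (fun w => (Pre.charge w).toAdd) fun _ _ h => congrArg _ (h 0).1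

/-- The total exponent of the second lamp. -/
def cocharge (g : Gam) : ℤ :=
  Con.liftOn g (fun w => (Pre.cocharge w).toAdd) fun _ _ h => congrArg _ (h 0).2

theorem sec_mk (j : ZMod 2) (w : Pre) : sec j (mk w) = mk ((Pre.wreath w).sec j) := rfl
theorem shift_mk (w : Pre) : shift (mk w) = (Pre.wreath w).shift := rfl
theorem area_mk (w : Pre) : area (mk w) = (Pre.wreath w).area := rfl
theorem charge_mk (w : Pre) : charge (mk w) = (Pre.charge w).toAdd := rfl
theorem cocharge_mk (w : Pre) : cocharge (mk w) = (Pre.cocharge w).toAdd := rfl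

theorem ext {g h : Gam} (hs : shift g = shift h) (ha : area g = area h)
    (hj : ∀ j, sec j g = sec j h) : g = h := by
  obtain ⟨x, rfl⟩ := mk_surjective g
  obtain ⟨y, rfl⟩ := mk_surjective h
  have hx : ∀ n, Pre.Agree (n + 1) x y := fun n => ⟨hs, ha, fun j => mk_eq.1 (hj j) n⟩
  refine mk_eq.2 fun n => ?_
  cases n with
  | zero => exact (hx 0).charge_eq
  | succ n => exact hx n

@[simp] theorem sec_mul (j : ZMod 2) (g h : Gam) :
    sec j (g * h) = sec j g * sec (j + shift g) h := by
  obtain ⟨x, rfl⟩ := mk_surjective g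
  obtain ⟨y, rfl⟩ := mk_surjective h
  rw [← map_mul, sec_mk, map_mul, Wreath.sec_mul, map_mul]
  rfl

@[simp] theorem shift_mul (g h : Gam) : shift (g * h) = shift g + shift h := by
  obtain ⟨x, rfl⟩ := mk_surjective g
  obtain ⟨y, rfl⟩ := mk_surjective h
  rw [← map_mul, shift_mk, map_mul]
  rfl

theorem area_mul (g h : Gam) : area (g * h) = area g + area h +
    (charge (sec 0 g) * cocharge (sec (1 + shift g) h) +
      charge (sec 1 g) * cocharge (sec (shift g) h)) := by
  obtain ⟨x, rfl⟩ := mk_surjective g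
  obtain ⟨y, rfl⟩ := mk_surjective h
  have h2 : ∀ f : ZMod 2 → ℤ, ∑ j, f j = f 0 + f 1 := Fin.sum_univ_two
  have h11 : (1 + 1 : ZMod 2) = 0 := rfl
  rw [← map_mul, area_mk, map_mul, Wreath.area_mul, h2]
  simp only [area_mk, sec_mk, charge_mk, cocharge_mk, shift_mk, zero_add, h11]

@[simp] theorem charge_mul (g h : Gam) : charge (g * h) = charge g + charge h := by
  obtain ⟨x, rfl⟩ := mk_surjective g
  obtain ⟨y, rfl⟩ := mk_surjective h
  rw [← map_mul, charge_mk, map_mul]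
  rfl

@[simp] theorem cocharge_mul (g h : Gam) : cocharge (g * h) = cocharge g + cocharge h := by
  obtain ⟨x, rfl⟩ := mk_surjective g
  obtain ⟨y, rfl⟩ := mk_surjective h
  rw [← map_mul, cocharge_mk, map_mul]
  rfl

theorem charge_eq (g : Gam) : charge g = charge (sec 0 g) + charge (sec 1 g) := by
  obtain ⟨x, rfl⟩ := mk_surjective g
  exact (Pre.charge_eq_sum x).trans (Fin.sum_univ_two _)

theorem cocharge_eq (g : Gam) : cocharge g = cocharge (sec 0 g) + cocharge (sec 1 g) := by
  obtain ⟨x, rfl⟩ := mk_surjective g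
  exact (Pre.cocharge_eq_sum x).trans (Fin.sum_univ_two _)

@[simp] theorem sec_one (j : ZMod 2) : sec j 1 = 1 := rfl
@[simp] theorem shift_one : shift 1 = 0 := rfl
@[simp] theorem area_one : area 1 = 0 := rfl
@[simp] theorem charge_one : charge 1 = 0 := rfl
@[simp] theorem cocharge_one : cocharge 1 = 0 := rfl

@[simp] theorem shift_inv (g : Gam) : shift g⁻¹ = -shift g := by
  have := shift_mul g g⁻¹; simp at this; omega

@[simp] theorem charge_inv (g : Gam) : charge g⁻¹ = -charge g := by
  have := charge_mul g g⁻¹; simp at this; omega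

@[simp] theorem cocharge_inv (g : Gam) : cocharge g⁻¹ = -cocharge g := by
  have := cocharge_mul g g⁻¹; simp at this; omega

@[simp] theorem sec_inv (j : ZMod 2) (g : Gam) : sec j g⁻¹ = (sec (j - shift g) g)⁻¹ := by
  have := sec_mul j g⁻¹ g
  rw [inv_mul_cancel, sec_one, shift_inv, Int.cast_neg, ← sub_eq_add_neg] at this
  exact eq_inv_of_mul_eq_one_left this.symm

/-- The rooted elements. -/
def rot (i : ℤ) : Gam := mk (Pre.rot (.ofAdd i))

/-- The directed elements. -/
def dir (β : Letter) : Gam := mk (Pre.dir (.ofAdd β))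

theorem rot_add (i j : ℤ) : rot (i + j) = rot i * rot j := by simp [rot]
@[simp] theorem rot_zero : rot 0 = 1 := by simp [rot]
theorem rot_neg (i : ℤ) : rot (-i) = (rot i)⁻¹ := by simp [rot]
theorem dir_add (x y : Letter) : dir (x + y) = dir x * dir y := by simp [dir]
@[simp] theorem dir_zero : dir 0 = 1 := by simp [dir]

@[simp] theorem sec_rot (j : ZMod 2) (i : ℤ) : sec j (rot i) = 1 := by
  simp [rot, sec_mk, Pre.wreath, Pre.rot, Wreath.rot]
@[simp] theorem shift_rot (i : ℤ) : shift (rot i) = i := rfl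
@[simp] theorem area_rot (i : ℤ) : area (rot i) = 0 := rfl
@[simp] theorem charge_rot (i : ℤ) : charge (rot i) = 0 := rfl
@[simp] theorem cocharge_rot (i : ℤ) : cocharge (rot i) = 0 := rfl

theorem sec_dir (j : ZMod 2) (β : Letter) :
    sec j (dir β) = if j = 0 then rot β.spin else dir β.turn := by
  by_cases hj : j = 0 <;> simp [hj, dir, sec_mk, Pre.wreath, Pre.dir, Wreath.dir, rot]
@[simp] theorem sec_zero_dir (β : Letter) : sec 0 (dir β) = rot β.spin := rfl
@[simp] theorem sec_one_dir (β : Letter) : sec 1 (dir β) = dir β.turn := rfl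
@[simp] theorem shift_dir (β : Letter) : shift (dir β) = 0 := rfl
@[simp] theorem area_dir (β : Letter) : area (dir β) = 0 := rfl
@[simp] theorem charge_dir (β : Letter) : charge (dir β) = β.2.2.1 := rfl
@[simp] theorem cocharge_dir (β : Letter) : cocharge (dir β) = β.2.2.2 := rfl

@[elab_as_elim]
theorem induction {P : Gam → Prop} (g : Gam) (hr : ∀ i, P (rot i)) (hd : ∀ β, P (dir β))
    (hm : ∀ g h, P g → P h → P (g * h)) : P g := by
  obtain ⟨x, rfl⟩ := mk_surjective g
  induction x using Monoid.Coprod.induction_on with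
  | inl i => exact hr i.toAdd
  | inr β => exact hd β.toAdd
  | mul x y hx hy => rw [map_mul]; exact hm _ _ hx hy

theorem rot_eq_zpow (i : ℤ) : rot i = rot 1 ^ i := by
  rw [rot, rot, ← map_zpow, ← map_zpow, ← ofAdd_zsmul]; simp

theorem dir_zsmul (n : ℤ) (β : Letter) : dir (n • β) = dir β ^ n := by
  rw [dir, dir, ← map_zpow, ← map_zpow, ← ofAdd_zsmul]

theorem dir_nsmul (n : ℕ) (β : Letter) : dir (n • β) = dir β ^ n := by
  rw [dir, dir, ← map_pow, ← map_pow, ← ofAdd_nsmul]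

theorem fg : Group.FG Gam := by
  classical
  refine ⟨⟨{rot 1, dir (1, 0, 0, 0), dir (0, 1, 0, 0), dir (0, 0, 1, 0), dir (0, 0, 0, 1)}, ?_⟩⟩
  rw [eq_top_iff]
  intro g _
  set H := Subgroup.closure (({rot 1, dir (1, 0, 0, 0), dir (0, 1, 0, 0), dir (0, 0, 1, 0),
    dir (0, 0, 0, 1)} : Finset Gam) : Set Gam)
  induction g using induction with
  | hr i =>
    rw [rot_eq_zpow]
    exact H.zpow_mem (Subgroup.subset_closure (by simp)) _
  | hd β =>
    obtain ⟨j, k, p, q⟩ := β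
    have : ((j, k, p, q) : Letter) = j • (1, 0, 0, 0) + (k • (0, 1, 0, 0) +
      (p • (0, 0, 1, 0) + q • (0, 0, 0, 1))) := by simp
    rw [this]
    simp only [dir_add, dir_zsmul]
    exact H.mul_mem (H.zpow_mem (Subgroup.subset_closure (by simp)) _) <|
      H.mul_mem (H.zpow_mem (Subgroup.subset_closure (by simp)) _) <|
      H.mul_mem (H.zpow_mem (Subgroup.subset_closure (by simp)) _) <|
      H.zpow_mem (Subgroup.subset_closure (by simp)) _
  | hm g h hg hh => exact H.mul_mem (hg trivial) (hh trivial)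

end Gam

/-! ### Weights and norms of letters -/

namespace Letter

/-- The weight of a letter, which depends only on the parities of the directed exponents. -/
def weight (β : Letter) : ℕ :=
  if Even β.2.1 then (if Even β.1 then 2 else 6) else (if Even β.1 then 4 else 2)

/-- The classes b, c, d weigh 6, 4, 2, with 6 = 4 + 2 the tight case. The even class weighs 2
instead of 0, so that cost also bounds length. -/
theorem weight_add (x y : Letter) : (x + y).weight ≤ x.weight + y.weight := by
  simp only [weight, Prod.fst_add, Prod.snd_add, Int.even_add]
  by_cases h1 : Even x.1 <;> by_cases h2 : Even y.1 <;> by_cases h3 : Even x.2.1 <;>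
    by_cases h4 : Even y.2.1 <;> simp [h1, h2, h3, h4]

theorem one_le_weight (x : Letter) : 1 ≤ x.weight := by
  unfold weight
  split_ifs <;> norm_num

theorem weight_le (x : Letter) : x.weight ≤ 6 := by
  unfold weight
  split_ifs <;> norm_num

/-- The price of an odd rotation. -/
def toll (i : ZMod 2) : ℕ := if i = 0 then 0 else 5

/-- The contraction for a single letter. `turn` cycles b, c, d and the spin is odd exactly for b and
c; the cases b, c, d, even read 63 ≤ 66, 49 ≤ 54, 42 ≤ 42, 14 ≤ 42. -/
theorem weight_turn_le (β : Letter) :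
    7 * (toll (β.spin : ℤ) + β.turn.weight) ≤ 6 * (β.weight + 5) := by
  have h : ((β.spin : ℤ) : ZMod 2) = 0 ↔ Even β.spin := by
    rw [ZMod.intCast_eq_zero_iff_even]
  rw [toll, if_congr h rfl rfl]
  simp only [weight, turn, spin, AddMonoidHom.coe_mk, ZeroHom.coe_mk, Int.even_sub, even_neg]
  by_cases h1 : Even β.1 <;> by_cases h2 : Even β.2.1 <;> simp [h1, h2]

/-- A norm on letters invariant under `turn`. -/
def size (β : Letter) : ℕ :=
  β.1.natAbs + β.2.1.natAbs + (β.1 - β.2.1).natAbs + β.2.2.1.natAbs + β.2.2.2.natAbs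

theorem size_add (x y : Letter) : (x + y).size ≤ x.size + y.size := by
  have h1 := Int.natAbs_add_le x.1 y.1
  have h2 := Int.natAbs_add_le x.2.1 y.2.1
  have h3 := Int.natAbs_add_le (x.1 - x.2.1) (y.1 - y.2.1)
  have h4 := Int.natAbs_add_le x.2.2.1 y.2.2.1
  have h5 := Int.natAbs_add_le x.2.2.2 y.2.2.2
  rw [sub_add_sub_comm] at h3
  simp only [size, Prod.fst_add, Prod.snd_add]
  linarith

/-- Up to sign, `turn` permutes the two directed exponents and their difference; hence the redundant
third term in `size`. -/
theorem size_turn (x : Letter) : x.turn.size = x.size := by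
  simp only [size, turn, AddMonoidHom.coe_mk, ZeroHom.coe_mk]
  omega

theorem spin_le_size (x : Letter) : x.spin.natAbs ≤ x.size := by
  simp only [size, spin, AddMonoidHom.coe_mk, ZeroHom.coe_mk]
  omega

theorem charge_le_size (x : Letter) : x.2.2.1.natAbs ≤ x.size := by
  simp only [size]
  omega

theorem cocharge_le_size (x : Letter) : x.2.2.2.natAbs ≤ x.size := by
  simp only [size]
  omega

end Letter

/-! ### Words, their sections and the contraction of cost -/

namespace Gam

/-- The conjugate of a directed element by a rooted element of the given parity. -/
def tw (ε : ZMod 2) (β : Letter) : Gam := rot ε.val * dir β * (rot ε.val)⁻¹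

@[simp] theorem shift_tw (ε : ZMod 2) (β : Letter) : shift (tw ε β) = 0 := by simp [tw]

theorem sec_tw (j ε : ZMod 2) (β : Letter) :
    sec j (tw ε β) = if j = ε then rot β.spin else dir β.turn := by
  have h : j + ε = 0 ↔ j = ε := by
    rw [add_eq_zero_iff_eq_neg, ZMod.neg_eq_self_mod_two]
  simp [tw, sec_dir, h]

@[simp] theorem area_tw (ε : ZMod 2) (β : Letter) : area (tw ε β) = 0 := by
  simp [tw, area_mul, ← rot_neg]

theorem rot_mul_tw (i : ℤ) (ε : ZMod 2) (β : Letter) :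
    rot i * tw ε β = tw (ε + i) β * rot i := by
  refine ext (by simp) (by simp [area_mul]) fun j => ?_
  have h : j + i = ε ↔ j = ε + i := by
    rw [← sub_eq_iff_eq_add, sub_eq_add_neg, ZMod.neg_eq_self_mod_two]
  simp [sec_tw, h]

theorem tw_mul_rot (i : ℤ) (ε : ZMod 2) (β : Letter) :
    tw ε β * rot i = rot i * tw (ε + i) β := by
  rw [rot_mul_tw, add_assoc, CharTwo.add_self_eq_zero, add_zero]

theorem tw_zero (β : Letter) : tw 0 β = dir β := by simp [tw]

theorem tw_add (ε : ZMod 2) (x y : Letter) : tw ε (x + y) = tw ε x * tw ε y := by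
  simp [tw, dir_add, mul_assoc]

/-- Words in conjugates of directed letters. -/
abbrev Word : Type := List (ZMod 2 × Letter)

/-- The element represented by a word. -/
def eval : Word → Gam
  | [] => 1
  | x :: L => tw x.1 x.2 * eval L

@[simp] theorem eval_nil : eval [] = 1 := rfl
@[simp] theorem eval_cons (x : ZMod 2 × Letter) (L : Word) : eval (x :: L) = tw x.1 x.2 * eval L :=
  rfl

theorem eval_append (L L' : Word) : eval (L ++ L') = eval L * eval L' := by
  induction L with
  | nil => simp
  | cons x L ih => simp [ih, mul_assoc]

@[simp] theorem shift_eval (L : Word) : shift (eval L) = 0 := by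
  induction L with
  | nil => rfl
  | cons x L ih => simp [ih]

/-- Conjugation of a word by a rooted element. -/
def conj (i : ZMod 2) (L : Word) : Word := L.map fun x => (x.1 + i, x.2)

theorem eval_mul_rot (L : Word) (i : ℤ) : eval L * rot i = rot i * eval (conj i L) := by
  induction L with
  | nil => simp [conj]
  | cons x L ih =>
    rw [eval_cons, mul_assoc, ih, ← mul_assoc, tw_mul_rot, mul_assoc]
    rfl

/-- The total size of a word. -/
def size (L : Word) : ℕ := (L.map fun x => x.2.size).sum

@[simp] theorem size_nil : size [] = 0 := rfl
@[simp] theorem size_cons (x : ZMod 2 × Letter) (L : Word) : size (x :: L) = x.2.size + size L := by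
  simp [size]
theorem size_append (L L' : Word) : size (L ++ L') = size L + size L' := by simp [size]
theorem size_conj (i : ZMod 2) (L : Word) : size (conj i L) = size L := by
  simp [size, conj, Function.comp_def]

open Letter in
/-- The cost of a word read from a given parity: letters cost their weights, and changes of parity
have to be paid for. -/
def cost : ZMod 2 → Word → ℕ
  | _, [] => 0
  | p, x :: L => x.2.weight + toll (p + x.1) + cost x.1 L

open Letter in
theorem toll_add_le (x y : ZMod 2) : toll (x + y) ≤ toll x + toll y := by
  revert x y; decide

open Letter in
theorem cost_add_le (i p : ZMod 2) (L : Word) : cost (i + p) L ≤ toll i + cost p L := by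
  cases L with
  | nil => simp [cost]
  | cons x L =>
    have := toll_add_le i (p + x.1)
    simp only [cost, add_assoc] at this ⊢
    omega

theorem cost_le (p : ZMod 2) (L : Word) : cost p L ≤ 11 * L.length := by
  induction L generalizing p with
  | nil => simp [cost]
  | cons x L ih =>
    have h1 := ih x.1
    have h2 := x.2.weight_le
    have h3 : ∀ i, Letter.toll i ≤ 5 := by decide
    have h4 := h3 (p + x.1)
    simp only [cost, List.length_cons]
    omega

theorem length_le_cost (p : ZMod 2) (L : Word) : L.length ≤ cost p L := by
  induction L generalizing p with
  | nil => simp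
  | cons x L ih =>
    have h1 := ih x.1
    have h2 := x.2.one_le_weight
    simp only [cost, List.length_cons]
    omega

/-- A word is alternating if the parities of consecutive letters differ. -/
abbrev Alternating (L : Word) : Prop := L.IsChain fun x y => x.1 ≠ y.1

-- Neighbouring letters of equal parity merge into one by `tw_add`; subadditivity of size and weight
-- keeps every measure from growing.
open Letter in
theorem exists_alternating (L : Word) : ∃ L' : Word, Alternating L' ∧ eval L' = eval L ∧
    L'.length ≤ L.length ∧ size L' ≤ size L ∧ ∀ p, cost p L' ≤ cost p L := by
  induction L with
  | nil => exact ⟨[], .nil, rfl, le_rfl, le_rfl, fun _ => le_rfl⟩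
  | cons x L ih =>
    obtain ⟨L', ha, he, hl, hs, hc⟩ := ih
    cases L' with
    | nil =>
      refine ⟨[x], .singleton x, by simp [← he], by simp, by simp, fun p => ?_⟩
      simp [cost]
    | cons y L'' =>
      by_cases hxy : x.1 = y.1
      · refine ⟨(x.1, x.2 + y.2) :: L'', ?_, ?_, ?_, ?_, fun p => ?_⟩
        · cases L'' with
          | nil => exact .singleton _
          | cons z L₃ =>
            rw [Alternating, List.isChain_cons_cons] at ha ⊢
            exact ⟨hxy ▸ ha.1, ha.2⟩
        · rw [eval_cons, eval_cons, ← he, eval_cons, tw_add, ← hxy, mul_assoc]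
        · simp only [List.length_cons] at hl ⊢
          omega
        · have := x.2.size_add y.2
          simp only [size_cons] at hs ⊢
          omega
        · have h1 := x.2.weight_add y.2
          have h2 := hc x.1
          simp only [cost, ← hxy] at h2 ⊢
          omega
      · refine ⟨x :: y :: L'', ?_, by simp [← he], ?_, ?_, fun p => ?_⟩
        · exact List.isChain_cons_cons.2 ⟨hxy, ha⟩
        · simp only [List.length_cons] at hl ⊢
          omega
        · simp only [size_cons] at hs ⊢
          omega
        · have := hc x.1
          simp only [cost] at this ⊢
          omega

/-- The section of a word: the exponent of the rooted part, and a word. -/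
def secWord (j : ZMod 2) : Word → ℤ × Word
  | [] => (0, [])
  | x :: L => if j = x.1 then (x.2.spin + (secWord j L).1, (secWord j L).2)
      else ((secWord j L).1, (((secWord j L).1 : ZMod 2), x.2.turn) :: (secWord j L).2)

theorem sec_eval (j : ZMod 2) (L : Word) :
    sec j (eval L) = rot (secWord j L).1 * eval (secWord j L).2 := by
  induction L with
  | nil => simp [secWord]
  | cons x L ih =>
    rw [eval_cons, sec_mul, shift_tw, Int.cast_zero, add_zero, ih, sec_tw, secWord]
    split_ifs with h
    · rw [rot_add, mul_assoc]
    -- Pulling the rooted part to the left conjugates the turned letter, which thereby acquires the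
    -- current parity.
    · rw [eval_cons, ← tw_zero, ← mul_assoc, tw_mul_rot, zero_add, mul_assoc]

theorem secWord_size (j : ZMod 2) (L : Word) :
    (secWord j L).1.natAbs + size (secWord j L).2 ≤ size L := by
  induction L with
  | nil => simp [secWord]
  | cons x L ih =>
    have h1 := x.2.spin_le_size
    have h2 := x.2.size_turn
    rw [secWord]
    split_ifs with h <;> simp only [size_cons] <;> omega

-- Each letter sends its spin to one section and its turn to the other. The spin costs at most its
-- toll, and the turned letter has exactly the current parity, so it pays only its weight;
-- `weight_turn_le` then adds up.
open Letter in
theorem cost_secWord (L : Word) :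
    7 * (cost (secWord 0 L).1 (secWord 0 L).2 + cost (secWord 1 L).1 (secWord 1 L).2) ≤
      6 * (L.map fun x => x.2.weight + 5).sum := by
  induction L with
  | nil => simp [secWord, cost]
  | cons x L ih =>
    have h1 := x.2.weight_turn_le
    have h2 : ∀ j : ZMod 2, j = 0 ∨ j = 1 := by decide
    have h3 : toll 0 = 0 := rfl
    have h4 := fun j => cost_add_le (x.2.spin : ℤ) (secWord j L).1 (secWord j L).2
    have h5 := h4 0
    have h6 := h4 1
    rcases h2 x.1 with h | h
    · simp only [secWord, h, if_true, one_ne_zero, if_false, List.map_cons, List.sum_cons, cost,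
        Int.cast_add, CharTwo.add_self_eq_zero, h3]
      omega
    · simp only [secWord, h, if_true, zero_ne_one, if_false, List.map_cons, List.sum_cons, cost,
        Int.cast_add, CharTwo.add_self_eq_zero, h3]
      omega

-- Every letter but the first pays the full toll 5; the first may be read for free, whence the extra
-- 5.
open Letter in
theorem Alternating.sum_le {L : Word} (hL : Alternating L) (p : ZMod 2) :
    (L.map fun x => x.2.weight + 5).sum ≤ cost p L + 5 := by
  have key : ∀ (x : ZMod 2 × Letter) (L : Word), Alternating (x :: L) →
      (L.map fun x => x.2.weight + 5).sum ≤ cost x.1 L := by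
    intro x L
    induction L generalizing x with
    | nil => simp
    | cons y L ih =>
      intro h
      rw [Alternating, List.isChain_cons_cons] at h
      have h1 : ∀ a b : ZMod 2, a ≠ b → toll (a + b) = 5 := by decide
      have h2 := h1 _ _ h.1
      have h3 := ih y h.2
      simp only [List.map_cons, List.sum_cons, cost]
      omega
  cases L with
  | nil => simp
  | cons x L =>
    have := key x L hL
    simp only [List.map_cons, List.sum_cons, cost]
    omega

theorem length_secWord_le (j : ZMod 2) (L : Word) : (secWord j L).2.length ≤ L.length := by
  induction L with
  | nil => simp [secWord]
  | cons x L ih =>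
    rw [secWord]
    split_ifs <;> simp only [List.length_cons] <;> omega

/-- Among two letters of different parities, one becomes rooted in any given section, which
therefore loses a letter. -/
theorem Alternating.length_secWord_lt {L : Word} (hL : Alternating L) (h2 : 2 ≤ L.length)
    (j : ZMod 2) : (secWord j L).2.length < L.length := by
  match L, h2 with
  | x :: y :: L, _ =>
    rw [Alternating, List.isChain_cons_cons] at hL
    have h1 : ∀ a b j : ZMod 2, a ≠ b → j = a ∨ j = b := by decide
    have h3 := length_secWord_le j L
    rw [secWord]
    split_ifs with h
    · have := length_secWord_le j (y :: L)
      simp only [List.length_cons] at this ⊢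
      omega
    · rw [secWord, if_pos ((h1 _ _ j hL.1).resolve_left h)]
      simp only [List.length_cons]
      omega

theorem exists_eval (g : Gam) : ∃ L, g = rot (shift g) * eval L := by
  induction g using induction with
  | hr i => exact ⟨[], by simp⟩
  | hd β => exact ⟨[(0, β)], by simp [tw_zero]⟩
  | hm g h hg hh =>
    obtain ⟨L, hL⟩ := hg
    obtain ⟨L', hL'⟩ := hh
    refine ⟨conj (shift h) L ++ L', ?_⟩
    rw [eval_append, shift_mul, rot_add, mul_assoc, ← mul_assoc (rot (shift h)), ← eval_mul_rot,
      mul_assoc (eval L), ← hL', ← mul_assoc, ← hL]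

/-- Induction on the number of letters of an alternating word: it suffices to treat rooted elements,
conjugates of directed elements, and elements whose sections are under control. -/
theorem section_induction {P : Gam → Prop} (h0 : ∀ i, P (rot i))
    (h1 : ∀ i ε β, P (rot i * tw ε β)) (h2 : ∀ g, (∀ j, P (sec j g)) → P g) (g : Gam) : P g := by
  have key : ∀ (n : ℕ) (g : Gam) (L : Word) (i : ℤ), L.length ≤ n → g = rot i * eval L → P g := by
    intro n
    induction n with
    | zero =>
      intro g L i hn hg
      rw [List.length_eq_zero_iff.1 (Nat.le_zero.1 hn)] at hg
      rw [hg, eval_nil, mul_one]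
      exact h0 i
    | succ n ih =>
      intro g L i hn hg
      obtain ⟨L', ha, he, hl, -⟩ := exists_alternating L
      rw [← he] at hg
      subst hg
      by_cases hl2 : 2 ≤ L'.length
      · refine h2 _ fun j => ?_
        refine ih _ (secWord (j + i) L').2 (secWord (j + i) L').1 ?_ ?_
        · have := ha.length_secWord_lt hl2 (j + i)
          omega
        · simp [sec_eval]
      · match L', hl2 with
        | [], _ => simpa using h0 i
        | [x], _ => simpa using h1 i x.1 x.2
        | x :: y :: L, h => simp at h
  obtain ⟨L, hL⟩ := exists_eval g
  exact key _ g L _ le_rfl hL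

theorem abs_cocharge_eval (L : Word) : (cocharge (eval L)).natAbs ≤ size L := by
  induction L with
  | nil => simp
  | cons x L ih =>
    have := x.2.cocharge_le_size
    simp only [eval_cons, cocharge_mul, tw, cocharge_rot, cocharge_dir, cocharge_inv, size_cons]
    omega

/-- Prepending a letter changes the area by its first lamp exponent times the cocharge of one
section of the rest. -/
theorem abs_area_eval (L : Word) : (area (eval L)).natAbs ≤ size L ^ 2 := by
  induction L with
  | nil => simp
  | cons x L ih =>
    have hc : ∀ j, (cocharge (sec j (eval L))).natAbs ≤ size L := by
      intro j
      rw [sec_eval, cocharge_mul, cocharge_rot, zero_add]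
      have h1 := abs_cocharge_eval (secWord j L).2
      have h2 := secWord_size j L
      omega
    have h2 : ∀ j : ZMod 2, j = 0 ∨ j = 1 := by decide
    have hx := x.2.charge_le_size
    have key : ∀ c : ℤ, c.natAbs ≤ size L →
        (area (eval L) + x.2.2.2.1 * c).natAbs ≤ (x.2.size + size L) ^ 2 := by
      intro c hc
      calc (area (eval L) + x.2.2.2.1 * c).natAbs
          ≤ (area (eval L)).natAbs + x.2.2.2.1.natAbs * c.natAbs := by
            rw [← Int.natAbs_mul]; exact Int.natAbs_add_le _ _
        _ ≤ size L ^ 2 + x.2.size * size L := by gcongr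
        _ ≤ (x.2.size + size L) ^ 2 := by nlinarith
    rw [eval_cons, area_mul, size_cons, area_tw, shift_tw]
    have ht : x.2.turn.2.2.1 = x.2.2.2.1 := rfl
    rcases h2 x.1 with h | h
    · simpa [h, sec_tw, ht] using key _ (hc 0)
    · simpa [h, sec_tw, ht] using key _ (hc 1)

/-! ### Torsion-freeness -/

theorem shift_pow (g : Gam) (k : ℕ) : shift (g ^ k) = k * shift g := by
  induction k with
  | zero => simp
  | succ k ih => rw [pow_succ, shift_mul, ih]; push_cast; ring

theorem sec_pow {g : Gam} (hg : shift g = 0) (j : ZMod 2) (k : ℕ) :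
    sec j (g ^ k) = sec j g ^ k := by
  induction k with
  | zero => simp
  | succ k ih => rw [pow_succ, sec_mul, ih, shift_pow, hg, pow_succ]; simp

theorem area_pow {g : Gam} (hg : ∀ j, sec j g = 1) (k : ℕ) : area (g ^ k) = k * area g := by
  induction k with
  | zero => simp
  | succ k ih => rw [pow_succ, area_mul, ih]; simp [hg]; ring

theorem rot_eq_one {i : ℤ} (h : rot i = 1) : i = 0 := congrArg shift h

/-- The spins at two consecutive levels determine the directed exponents, and the charges determine
the lamps. -/
theorem dir_eq_one {β : Letter} (h : dir β = 1) : β = 0 := by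
  have h1 : sec 0 (dir β) = 1 := by rw [h, sec_one]
  have h2 : sec 1 (dir β) = 1 := by rw [h, sec_one]
  have h3 : sec 0 (sec 1 (dir β)) = 1 := by rw [h2, sec_one]
  have h4 := congrArg charge h
  have h5 := congrArg cocharge h
  rw [sec_zero_dir] at h1
  rw [sec_one_dir, sec_zero_dir] at h3
  have h6 := rot_eq_one h1
  have h7 := rot_eq_one h3
  simp only [Letter.spin, Letter.turn, AddMonoidHom.coe_mk, ZeroHom.coe_mk] at h6 h7
  simp only [charge_dir, charge_one, cocharge_dir, cocharge_one] at h4 h5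
  ext <;> simp <;> omega

theorem tw_pow (ε : ZMod 2) (β : Letter) (k : ℕ) : tw ε β ^ k = tw ε (k • β) := by
  rw [tw, tw, dir_nsmul, conj_pow]

theorem tw_eq_one {ε : ZMod 2} {β : Letter} (h : tw ε β = 1) : β = 0 := by
  rw [tw, conj_eq_one_iff] at h
  exact dir_eq_one h

/-- A torsion element has shift 0, so its sections are torsion too. Once they are trivial, the area
is multiplied by k in the k-th power and must vanish. -/
theorem torsionFree : TorsionFreeGroup Gam := by
  suffices h : ∀ g : Gam, ∀ k : ℕ, k ≠ 0 → g ^ k = 1 → g = 1 by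
    intro g hg
    obtain ⟨k, hk, hgk⟩ := isOfFinOrder_iff_pow_eq_one.1 hg
    exact h g k hk.ne' hgk
  have hs : ∀ g : Gam, ∀ k : ℕ, k ≠ 0 → g ^ k = 1 → shift g = 0 := by
    intro g k hk h
    have := shift_pow g k
    rw [h, shift_one] at this
    simpa [hk] using this.symm
  refine section_induction ?_ ?_ ?_
  · intro i k hk h
    have : i = 0 := hs _ k hk h
    rw [this, rot_zero]
  · intro i ε β k hk h
    have hi := hs _ k hk h
    simp only [shift_mul, shift_rot, shift_tw, add_zero] at hi
    rw [hi, rot_zero, one_mul] at h ⊢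
    rw [tw_pow] at h
    have := (smul_eq_zero.1 (tw_eq_one h)).resolve_left hk
    simp [tw, this]
  · intro g ih k hk h
    have h0 := hs g k hk h
    have hj : ∀ j, sec j g = 1 := fun j => ih j k hk (by rw [← sec_pow h0, h, sec_one])
    have ha := area_pow hj k
    rw [h, area_one] at ha
    exact ext h0 (by simpa [hk] using ha.symm) hj

/-! ### Counting cheap elements -/

/-- The elements represented by words of size at most `N` and cost at most `w`. -/
def cheap (N w : ℕ) : Set Gam :=
  {g | ∃ (m : ℤ) (L : Word) (p : ZMod 2), g = rot m * eval L ∧ m.natAbs ≤ N ∧ size L ≤ N ∧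
    cost p L ≤ w}

open scoped Pointwise in
theorem exists_finset_cheap (N w : ℕ) :
    ∃ A : Finset Gam, cheap N w ⊆ A ∧ A.card ≤ ((2 * N + 2) ^ 5) ^ (w + 1) := by
  classical
  let I : Finset ℤ := Finset.Icc (-N) N
  have hI : I.card = 2 * N + 1 := by simp [I]; omega
  have memI : ∀ z : ℤ, z.natAbs ≤ N → z ∈ I := by
    intro z hz
    simp only [I, Finset.mem_Icc]
    omega
  let T : Finset Gam := ((Finset.univ : Finset (ZMod 2)) ×ˢ (I ×ˢ I ×ˢ I ×ˢ I)).image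
    fun x => tw x.1 x.2
  have memT : ∀ ε β, β.size ≤ N → tw ε β ∈ T := by
    intro ε β hβ
    unfold Letter.size at hβ
    refine Finset.mem_image.2 ⟨(ε, β), ?_, rfl⟩
    simp only [Finset.mem_product, Finset.mem_univ, true_and]
    exact ⟨memI _ (by omega), memI _ (by omega), memI _ (by omega), memI _ (by omega)⟩
  have hT : T.card ≤ 2 * (2 * N + 1) ^ 4 := by
    refine Finset.card_image_le.trans (le_of_eq ?_)
    rw [Finset.card_product, Finset.card_product, Finset.card_product, Finset.card_product, hI,
      Finset.card_univ, ZMod.card]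
    ring
  have h1T : (1 : Gam) ∈ T := by
    have := memT 0 0 (by simp [Letter.size])
    rwa [tw_zero, dir_zero] at this
  have hL : ∀ L : Word, size L ≤ N → eval L ∈ T ^ L.length := by
    intro L
    induction L with
    | nil => simp
    | cons x L ih =>
      intro h
      rw [size_cons] at h
      rw [eval_cons, List.length_cons, pow_succ']
      exact Finset.mul_mem_mul (memT _ _ (by omega)) (ih (by omega))
  refine ⟨I.image rot * T ^ w, ?_, ?_⟩
  · rintro g ⟨m, L, p, rfl, hm, hs, hc⟩
    refine Finset.mem_coe.2 (Finset.mul_mem_mul (Finset.mem_image_of_mem _ (memI m hm)) ?_)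
    -- Since T contains 1, shorter products also lie in T ^ w.
    exact Finset.pow_subset_pow_right h1T ((length_le_cost p L).trans hc) (hL L hs)
  · have h1 : 2 * (2 * N + 1) ^ 4 ≤ (2 * N + 2) ^ 5 := by
      calc 2 * (2 * N + 1) ^ 4 ≤ (2 * N + 2) * (2 * N + 2) ^ 4 := by gcongr <;> omega
        _ = (2 * N + 2) ^ 5 := by ring
    have h2 : 2 * N + 1 ≤ (2 * N + 2) ^ 5 :=
      (show 2 * N + 1 ≤ 2 * N + 2 by omega).trans (Nat.le_self_pow (by norm_num) _)
    calc (I.image rot * T ^ w).card ≤ (I.image rot).card * (T ^ w).card := Finset.card_mul_le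
      _ ≤ (2 * N + 1) * (2 * (2 * N + 1) ^ 4) ^ w := by
        gcongr
        · exact Finset.card_image_le.trans hI.le
        · exact Finset.card_pow_le.trans (Nat.pow_le_pow_left hT w)
      _ ≤ (2 * N + 2) ^ 5 * ((2 * N + 2) ^ 5) ^ w := by gcongr
      _ = _ := (pow_succ' _ _).symm

theorem cheap_finite (N w : ℕ) : (cheap N w).Finite := by
  obtain ⟨A, hA, -⟩ := exists_finset_cheap N w
  exact A.finite_toSet.subset hA

theorem cheap_sections {N w : ℕ} {g : Gam} (hg : g ∈ cheap N w) :
    (∃ w₀ w₁, 7 * (w₀ + w₁) ≤ 6 * (w + 5) ∧ sec 0 g ∈ cheap N w₀ ∧ sec 1 g ∈ cheap N w₁) ∧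
      (shift g).natAbs ≤ N ∧ (area g).natAbs ≤ N ^ 2 := by
  obtain ⟨m, L, p, rfl, hm, hs, hc⟩ := hg
  obtain ⟨L', ha, he, -, hs', hc'⟩ := exists_alternating L
  rw [← he]
  have h1 := cost_secWord L'
  have h2 := ha.sum_le p
  have h3 := hc' p
  have hj : ∀ j, rot (secWord j L').1 * eval (secWord j L').2 ∈
      cheap N (cost (secWord j L').1 (secWord j L').2) := by
    intro j
    have := secWord_size j L'
    exact ⟨_, _, _, rfl, by omega, by omega, le_rfl⟩
  have h01 : ∀ j : ZMod 2, j = 0 ∨ j = 1 := by decide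
  have h11 : (1 + 1 : ZMod 2) = 0 := rfl
  refine ⟨?_, by simpa using hm, ?_⟩
  · simp only [sec_mul, sec_rot, one_mul, shift_rot]
    rcases h01 m with h | h
    · rw [h, add_zero, add_zero, sec_eval, sec_eval]
      exact ⟨_, _, by omega, hj 0, hj 1⟩
    · rw [h, zero_add, h11, sec_eval, sec_eval]
      exact ⟨_, _, by omega, hj 1, hj 0⟩
  · have := abs_area_eval L'
    rw [area_mul]
    simp only [area_rot, sec_rot, charge_one, zero_mul, add_zero, zero_add]
    exact this.trans (Nat.pow_le_pow_left (by omega) 2)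

/-- An element is determined by its sections, shift and area. The bound 30 ≤ N keeps the costs of
the sections at most N, because 6 (N + 5) ≤ 7 N. -/
theorem ncard_cheap_le_sum {N w : ℕ} (hN : 30 ≤ N) (hw : w ≤ N) :
    (cheap N w).ncard ≤ ∑ x ∈ ((Finset.range (N + 1)) ×ˢ (Finset.range (N + 1))).filter
      (fun x => 7 * (x.1 + x.2) ≤ 6 * (w + 5)),
        (cheap N x.1).ncard * (cheap N x.2).ncard * ((2 * N + 1) * (2 * N ^ 2 + 1)) := by
  classical
  let b : ℕ → Finset Gam := fun w => (cheap_finite N w).toFinset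
  have hb : ∀ w, (cheap N w).ncard = (b w).card := fun w => Set.ncard_eq_toFinset_card _ _
  have memb : ∀ w g, g ∈ b w ↔ g ∈ cheap N w := fun w g => Set.Finite.mem_toFinset _
  let I : ℕ → Finset ℤ := fun n => Finset.Icc (-n) n
  have hI : ∀ n, (I n).card = 2 * n + 1 := fun n => by simp [I]; omega
  have memI : ∀ (n : ℕ) (z : ℤ), z.natAbs ≤ n → z ∈ I n := by
    intro n z hz
    simp only [I, Finset.mem_Icc]
    omega
  simp only [hb]
  set K := ((Finset.range (N + 1)) ×ˢ (Finset.range (N + 1))).filter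
      (fun x => 7 * (x.1 + x.2) ≤ 6 * (w + 5)) with hK
  let f : Gam → (Gam × Gam) × ℤ × ℤ := fun g => ((sec 0 g, sec 1 g), shift g, area g)
  have hf : Function.Injective f := by
    intro g h hgh
    simp only [f, Prod.mk.injEq] at hgh
    refine ext hgh.2.1 hgh.2.2 fun j => ?_
    have h01 : ∀ j : ZMod 2, j = 0 ∨ j = 1 := by decide
    rcases h01 j with rfl | rfl
    · exact hgh.1.1
    · exact hgh.1.2
  calc (b w).card
      ≤ (K.biUnion fun x => (b x.1 ×ˢ b x.2) ×ˢ (I N ×ˢ I (N ^ 2))).card := by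
        refine Finset.card_le_card_of_injOn f (fun g hg => ?_) hf.injOn
        obtain ⟨⟨w₀, w₁, hww, h0, h1⟩, hs, ha⟩ := cheap_sections ((memb _ _).1 hg)
        refine Finset.mem_coe.2 (Finset.mem_biUnion.2 ⟨(w₀, w₁), ?_, ?_⟩)
        · simp only [hK, Finset.mem_filter, Finset.mem_product, Finset.mem_range]
          omega
        · simp only [f, Finset.mem_product, memb]
          exact ⟨⟨h0, h1⟩, memI _ _ hs, memI _ _ ha⟩
    _ ≤ ∑ x ∈ K, ((b x.1 ×ˢ b x.2) ×ˢ (I N ×ˢ I (N ^ 2))).card := Finset.card_biUnion_le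
    _ = _ := by simp only [Finset.card_product, hI]

/-- The exponent bounding the logarithm of the number of cheap elements after `t` decompositions. -/
noncomputable def expo (t w : ℕ) : ℝ := (6 / 7 : ℝ) ^ t * w + 7 * 2 ^ t - 6

/-- The constants a_t = 7 * 2 ^ t - 6 solve a_{t+1} = 2 a_t + 6 with a_0 = 1. Of the 6, the additive
5 in the contraction uses at most 5; the spare 1 is a factor P absorbing the choices of costs, shift
and area. -/
theorem ncard_cheap_le {N : ℕ} (hN : 30 ≤ N) (t : ℕ) : ∀ w ≤ N,
    ((cheap N w).ncard : ℝ) ≤ (((2 * N + 2) ^ 5 : ℕ) : ℝ) ^ expo t w := by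
  set P : ℕ := (2 * N + 2) ^ 5 with hP
  have hP1 : (1 : ℝ) ≤ P := by
    have : 1 ≤ P := Nat.one_le_pow _ _ (by omega)
    exact_mod_cast this
  have hP0 : (0 : ℝ) < P := by linarith
  induction t with
  | zero =>
    intro w _
    obtain ⟨A, hA, hc⟩ := exists_finset_cheap N w
    have h1 : (cheap N w).ncard ≤ P ^ (w + 1) := by
      refine (Set.ncard_le_ncard hA A.finite_toSet).trans ?_
      rwa [Set.ncard_coe_finset]
    have h2 : expo 0 w = ((w + 1 : ℕ) : ℝ) := by simp [expo]; ring
    rw [h2, Real.rpow_natCast]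
    exact_mod_cast h1
  | succ t ih =>
    intro w hw
    refine (Nat.cast_le.2 (ncard_cheap_le_sum hN hw)).trans ?_
    push_cast
    refine (Finset.sum_le_card_nsmul _ _
      ((P : ℝ) ^ (expo (t + 1) w - 1) * ((2 * N + 1) * (2 * N ^ 2 + 1))) ?_).trans ?_
    · intro x hx
      simp only [Finset.mem_filter, Finset.mem_product, Finset.mem_range] at hx
      refine mul_le_mul_of_nonneg_right ?_ (by positivity)
      refine (mul_le_mul (ih x.1 (by omega)) (ih x.2 (by omega)) (by positivity)
        (by positivity)).trans ?_
      rw [← Real.rpow_add hP0]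
      refine Real.rpow_le_rpow_of_exponent_le hP1 ?_
      have h1 : (7 : ℝ) * (x.1 + x.2) ≤ 6 * (w + 5) := by exact_mod_cast hx.2
      have h2 : (0 : ℝ) ≤ (6 / 7) ^ t := by positivity
      have h3 : (6 / 7 : ℝ) ^ t ≤ 1 := pow_le_one₀ (by norm_num) (by norm_num)
      have h4 : (6 / 7 : ℝ) ^ t * (x.1 + x.2) ≤ (6 / 7) ^ t * (6 / 7 * (w + 5)) :=
        mul_le_mul_of_nonneg_left (by linarith) h2
      simp only [expo, pow_succ]
      nlinarith
    · rw [nsmul_eq_mul]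
      have hcard : ((((Finset.range (N + 1)) ×ˢ (Finset.range (N + 1))).filter
          (fun x => 7 * (x.1 + x.2) ≤ 6 * (w + 5))).card : ℝ) ≤ (N + 1) ^ 2 := by
        have := Finset.card_filter_le ((Finset.range (N + 1)) ×ˢ (Finset.range (N + 1)))
          (fun x => 7 * (x.1 + x.2) ≤ 6 * (w + 5))
        rw [Finset.card_product, Finset.card_range, ← pow_two] at this
        exact_mod_cast this
      have hNP : ((N : ℝ) + 1) ^ 2 * ((2 * N + 1) * (2 * N ^ 2 + 1)) ≤ P := by
        have h1 : (N + 1) ^ 2 * ((2 * N + 1) * (2 * N ^ 2 + 1)) ≤ P := by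
          calc (N + 1) ^ 2 * ((2 * N + 1) * (2 * N ^ 2 + 1))
              ≤ (2 * N + 2) ^ 2 * ((2 * N + 2) * (2 * N + 2) ^ 2) :=
                Nat.mul_le_mul (Nat.pow_le_pow_left (by omega) 2)
                  (Nat.mul_le_mul (by omega) (by nlinarith))
            _ = P := by rw [hP]; ring
        exact_mod_cast h1
      have hsub : (P : ℝ) ^ (expo (t + 1) w) = P ^ (expo (t + 1) w - 1) * P := by
        rw [Real.rpow_sub_one hP0.ne', div_mul_cancel₀ _ hP0.ne']
      rw [hsub]
      have h0 : (0 : ℝ) ≤ (P : ℝ) ^ (expo (t + 1) w - 1) := by positivity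
      calc
        _ ≤ ((N : ℝ) + 1) ^ 2 * (P ^ (expo (t + 1) w - 1) * ((2 * N + 1) * (2 * N ^ 2 + 1))) := by
            gcongr
        _ = P ^ (expo (t + 1) w - 1) * (((N : ℝ) + 1) ^ 2 * ((2 * N + 1) * (2 * N ^ 2 + 1))) := by
            ring
        _ ≤ _ := mul_le_mul_of_nonneg_left hNP h0

end Gam

/-! ### Distances in Cayley graphs -/

section Cayley

open SimpleGraph

variable {G : Type*} [Group G]

theorem edist_mul_left_le (S : Set G) (d u v : G) :
    (mulCayley S).edist (d * u) (d * v) ≤ (mulCayley S).edist u v := by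
  by_cases h : (mulCayley S).edist u v = ⊤
  · rw [h]; exact le_top
  · obtain ⟨p, hp⟩ := exists_walk_of_edist_ne_top h
    let f : mulCayley S →g mulCayley S := ⟨fun x => d * x, fun h => mulCayley_adj_mul_iff_right.2 h⟩
    rw [← hp, ← p.length_map f]
    exact edist_le _

theorem edist_one_mul_le (S : Set G) (g h : G) :
    (mulCayley S).edist 1 (g * h) ≤ (mulCayley S).edist 1 g + (mulCayley S).edist 1 h := by
  refine (SimpleGraph.edist_triangle (v := g)).trans (add_le_add le_rfl ?_)
  simpa using edist_mul_left_le S g 1 h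

theorem edist_one_inv (S : Set G) (g : G) :
    (mulCayley S).edist 1 g⁻¹ ≤ (mulCayley S).edist 1 g := by
  have := edist_mul_left_le S g⁻¹ g 1
  rwa [inv_mul_cancel, mul_one, edist_comm (u := g)] at this

theorem edist_one_ne_top {S : Set G} (hS : Subgroup.closure S = ⊤) (g : G) :
    (mulCayley S).edist 1 g ≠ ⊤ := by
  have hg : g ∈ Subgroup.closure S := hS ▸ Subgroup.mem_top g
  induction hg using Subgroup.closure_induction with
  | mem x hx =>
    refine ne_top_of_le_ne_top ENat.one_ne_top (edist_le_one_iff_adj_or_eq.2 ?_)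
    by_cases h : 1 = x
    · exact Or.inr h
    · exact Or.inl ((mulCayley_adj S 1 x).2 ⟨h, Or.inl (by simpa using hx)⟩)
  | one => simp
  | mul x y _ _ hx hy =>
    exact ne_top_of_le_ne_top (WithTop.add_ne_top.2 ⟨hx, hy⟩) (edist_one_mul_le S x y)
  | inv x _ hx => exact ne_top_of_le_ne_top hx (edist_one_inv S x)

/-- Balls in a Cayley graph are contained in any increasing family of sets that is compatible with
multiplication by generators and their inverses. -/
theorem ball_subset {S : Set G} {U : ℕ → Set G} (hU : Monotone U) (h1 : 1 ∈ U 0)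
    (hs : ∀ n, ∀ u ∈ U n, ∀ s ∈ S, u * s ∈ U (n + 1) ∧ u * s⁻¹ ∈ U (n + 1)) (n : ℕ) :
    {g : G | (mulCayley S).edist 1 g ≤ n} ⊆ U n := by
  have key : ∀ (u v : G) (p : (mulCayley S).Walk u v) (k : ℕ), u ∈ U k → v ∈ U (k + p.length) := by
    intro u v p
    induction p with
    | nil => intro k h; simpa using h
    | @cons u v w h p ih =>
      intro k hu
      rw [mulCayley_adj'] at h
      obtain ⟨-, s, hsS, h | h⟩ := h
      · have := ih (k + 1) (h ▸ (hs k u hu s hsS).1)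
        rwa [Walk.length_cons, add_comm p.length, ← add_assoc]
      · have hv : v = u * s⁻¹ := by rw [h, mul_inv_cancel_right]
        have := ih (k + 1) (hv ▸ (hs k u hu s hsS).2)
        rwa [Walk.length_cons, add_comm p.length, ← add_assoc]
  intro g hg
  obtain ⟨p, hp⟩ := exists_walk_of_edist_ne_top (ne_top_of_le_ne_top (ENat.natCast_ne_top n) hg)
  have hpn : p.length ≤ n := by
    have : (p.length : ℕ∞) ≤ n := hp ▸ hg
    exact_mod_cast this
  exact hU (by simpa using hpn) (key 1 g p 0 h1)

end Cayley

/-! ### Subexponential growth -/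

namespace Gam

/-- The elements represented by words of bounded exponents, size and length. -/
def short (r : ℕ) : Set Gam :=
  {g | ∃ (m : ℤ) (L : Word), g = rot m * eval L ∧ m.natAbs ≤ r ∧ size L ≤ r ∧ L.length ≤ r}

theorem short_mono : Monotone short := by
  rintro r s h g ⟨m, L, hg, h1, h2, h3⟩
  exact ⟨m, L, hg, h1.trans h, h2.trans h, h3.trans h⟩

theorem short_mul {r s : ℕ} {g h : Gam} (hg : g ∈ short r) (hh : h ∈ short s) :
    g * h ∈ short (r + s) := by
  obtain ⟨m, L, rfl, h1, h2, h3⟩ := hg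
  obtain ⟨m', L', rfl, h1', h2', h3'⟩ := hh
  refine ⟨m + m', conj m' L ++ L', ?_, ?_, ?_, ?_⟩
  · rw [eval_append, rot_add, mul_assoc, mul_assoc, ← mul_assoc (eval L), eval_mul_rot, mul_assoc]
  · omega
  · rw [size_append, size_conj]; omega
  · rw [List.length_append, conj, List.length_map]; omega

theorem exists_mem_short (g : Gam) : ∃ r, g ∈ short r := by
  obtain ⟨L, hL⟩ := exists_eval g
  refine ⟨(shift g).natAbs + size L + L.length, shift g, L, hL, ?_, ?_, ?_⟩ <;> omega

/-- A letter costs at most 6 + 5 = 11; the 30 secures the lower bound on N required for counting. -/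
theorem short_subset_cheap (r : ℕ) : short r ⊆ cheap (11 * r + 30) (11 * r + 30) := by
  rintro g ⟨m, L, hg, h1, h2, h3⟩
  have := cost_le 0 L
  exact ⟨m, L, 0, hg, by omega, by omega, by omega⟩

theorem exists_ball_subset (S : Finset Gam) : ∃ r : ℕ, 0 < r ∧ ∀ n : ℕ,
    {g : Gam | (SimpleGraph.mulCayley (S : Set Gam)).edist 1 g ≤ (n : ℕ∞)} ⊆
      cheap (11 * (r * n) + 30) (11 * (r * n) + 30) := by
  choose r hr using exists_mem_short
  refine ⟨∑ s ∈ S, (r s + r s⁻¹) + 1, Nat.succ_pos _, fun n => ?_⟩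
  set R := ∑ s ∈ S, (r s + r s⁻¹) + 1
  refine (ball_subset (U := fun n => short (R * n)) ?_ ?_ ?_ n).trans (short_subset_cheap _)
  · exact fun a b h => short_mono (Nat.mul_le_mul_left R h)
  · exact ⟨0, [], by simp⟩
  · intro n u hu s hs
    have hR : r s + r s⁻¹ ≤ R := (Finset.single_le_sum (f := fun s => r s + r s⁻¹)
      (fun _ _ => Nat.zero_le _) hs).trans (Nat.le_succ _)
    constructor
    · exact short_mono (by rw [mul_add_one]; omega) (short_mul hu (hr s))
    · exact short_mono (by rw [mul_add_one]; omega) (short_mul hu (hr s⁻¹))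

theorem ball_finite (S : Finset Gam) (n : ℕ) :
    {g : Gam | (SimpleGraph.mulCayley (S : Set Gam)).edist 1 g ≤ (n : ℕ∞)}.Finite := by
  obtain ⟨r, -, hr⟩ := exists_ball_subset S
  exact (cheap_finite _ _).subset (hr n)

/-- The rate bounding the logarithm of the growth function divided by the radius. -/
noncomputable def rate (t : ℕ) : ℝ :=
  ((6 / 7 : ℝ) ^ t + 7 * (1 / 2) ^ t) * (5 * ((t + 2) * Real.log 4))

theorem tendsto_rate : Tendsto rate atTop (𝓝 0) := by
  have h : ∀ c : ℝ, 0 ≤ c → c < 1 → Tendsto (fun t : ℕ => (t + 2 : ℝ) * c ^ t) atTop (𝓝 0) := by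
    intro c h0 h1
    have := (tendsto_self_mul_const_pow_of_lt_one h0 h1).add
      ((tendsto_pow_atTop_nhds_zero_of_lt_one h0 h1).const_mul 2)
    simp only [mul_zero, add_zero] at this
    exact this.congr fun t => by ring
  have := ((h (6 / 7) (by norm_num) (by norm_num)).add
    ((h (1 / 2) (by norm_num) (by norm_num)).const_mul 7)).mul_const (5 * Real.log 4)
  simp only [mul_zero, add_zero, zero_mul] at this
  exact this.congr fun t => by unfold rate; ring

/-- With t = log₄ N, one has 2 ^ t ≤ N / 2 ^ t, so both terms of the exponent are N times something
decaying geometrically in t, while log P is only linear in t. -/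
theorem log_ncard_cheap_le {N : ℕ} (hN : 30 ≤ N) (hpos : 0 < (cheap N N).ncard) :
    Real.log (cheap N N).ncard ≤ N * rate (Nat.log 4 N) := by
  set t := Nat.log 4 N with ht
  have h1 : 4 ^ t ≤ N := Nat.pow_log_le_self 4 (by omega)
  have h2 : N < 4 ^ (t + 1) := Nat.lt_pow_succ_log_self (by norm_num) N
  have hN0 : (0 : ℝ) < N := by exact_mod_cast (by omega : 0 < N)
  have h3 := Real.log_le_log (by exact_mod_cast hpos) (ncard_cheap_le hN t N le_rfl)
  rw [Real.log_rpow (by positivity)] at h3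
  refine h3.trans ?_
  have h4 : Real.log ((2 * N + 2) ^ 5 : ℕ) ≤ 5 * ((t + 2) * Real.log 4) := by
    push_cast
    rw [Real.log_pow]
    refine mul_le_mul_of_nonneg_left ?_ (by norm_num)
    have h5 : (2 * (N : ℝ) + 2) ≤ 4 ^ (t + 2) := by
      have : 2 * N + 2 ≤ 4 ^ (t + 2) := by rw [pow_succ]; omega
      exact_mod_cast this
    have h6 := Real.log_le_log (by positivity) h5
    rw [Real.log_pow] at h6
    exact_mod_cast h6
  have h5 : expo t N ≤ N * ((6 / 7 : ℝ) ^ t + 7 * (1 / 2) ^ t) := by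
    have h6 : (2 : ℝ) ^ t ≤ N * (1 / 2) ^ t := by
      have h7 : (2 : ℝ) ^ t * 2 ^ t ≤ N := by
        rw [← mul_pow]
        norm_num
        exact_mod_cast h1
      rw [one_div, inv_pow, ← div_eq_mul_inv, le_div_iff₀ (by positivity)]
      exact h7
    unfold expo
    nlinarith
  rw [rate, ← mul_assoc]
  refine mul_le_mul h5 h4 (Real.log_natCast_nonneg _) (by positivity)

theorem rate_nonneg (t : ℕ) : 0 ≤ rate t := by
  unfold rate
  have := Real.log_nonneg (show (1 : ℝ) ≤ 4 by norm_num)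
  positivity

theorem one_le_growthFunction (S : Finset Gam) (n : ℕ) : 1 ≤ growthFunction S n := by
  rw [Nat.one_le_iff_ne_zero, growthFunction, Ne, Set.ncard_eq_zero (ball_finite S n)]
  exact Set.Nonempty.ne_empty ⟨1, by simp⟩

theorem subexponential (S : Finset Gam) : Subexponential (growthFunction S) := by
  obtain ⟨r, hr0, hr⟩ := exists_ball_subset S
  set N : ℕ → ℕ := fun n => 11 * (r * n) + 30 with hN
  have hv1 : ∀ n, (1 : ℝ) ≤ growthFunction S n := fun n => by
    exact_mod_cast one_le_growthFunction S n
  have hvN : ∀ n, growthFunction S n ≤ (cheap (N n) (N n)).ncard := fun n =>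
    Set.ncard_le_ncard (hr n) (cheap_finite _ _)
  have hNtop : Tendsto N atTop atTop := tendsto_atTop_mono
    (fun n => by have := Nat.le_mul_of_pos_left n hr0; simp only [hN, id]; omega) tendsto_id
  have hlogtop : Tendsto (fun n => Nat.log 4 (N n)) atTop atTop := by
    refine Tendsto.comp (g := Nat.log 4) (tendsto_atTop.2 fun b => ?_) hNtop
    filter_upwards [eventually_ge_atTop (4 ^ b)] with n hn
    exact Nat.le_log_of_pow_le (by norm_num) hn
  have hlim : Tendsto (fun n => Real.exp ((11 * r + 30) * rate (Nat.log 4 (N n)))) atTop (𝓝 1) := by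
    have := ((tendsto_rate.comp hlogtop).const_mul (11 * (r : ℝ) + 30))
    rw [mul_zero] at this
    have h2 := (Real.continuous_exp.tendsto 0).comp this
    rwa [Real.exp_zero] at h2
  refine tendsto_of_tendsto_of_tendsto_of_le_of_le' tendsto_const_nhds hlim ?_ ?_
  · exact Eventually.of_forall fun n => Real.one_le_rpow (hv1 n) (by positivity)
  · filter_upwards [eventually_ge_atTop 1] with n hn
    have hn0 : (0 : ℝ) < n := by exact_mod_cast hn
    rw [Real.rpow_def_of_pos (by linarith [hv1 n]), Real.exp_le_exp, mul_one_div,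
      div_le_iff₀ hn0]
    have hpos : 0 < (cheap (N n) (N n)).ncard := (one_le_growthFunction S n).trans (hvN n)
    calc Real.log (growthFunction S n) ≤ Real.log (cheap (N n) (N n)).ncard :=
          Real.log_le_log (by linarith [hv1 n]) (by exact_mod_cast hvN n)
      _ ≤ N n * rate (Nat.log 4 (N n)) := log_ncard_cheap_le (by simp only [hN]; omega) hpos
      _ ≤ ((11 * r + 30) * n) * rate (Nat.log 4 (N n)) := by
        refine mul_le_mul_of_nonneg_right ?_ (rate_nonneg _)
        have : N n ≤ (11 * r + 30) * n := by simp only [hN]; nlinarith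
        exact_mod_cast this
      _ = _ := by ring

end Gam

/-! ### Submodules of free modules over a principal ideal domain -/

section Free

variable {R ι : Type*} [CommRing R] [IsDomain R] [IsPrincipalIdealRing R]

/-- Over a principal ideal domain, submodules of free modules of arbitrary rank are free. -/
theorem free_submodule_finsupp [LinearOrder ι] [WellFoundedLT ι] (H : Submodule R (ι →₀ R)) :
    Module.Free R H := by
  classical
  -- `I i` is the ideal of coefficients at `i` of elements of `H` supported up to `i`. Elements
  -- realising its generator, for those `i` where it is nonzero, form the basis.
  let K : ι → Submodule R (ι →₀ R) := fun i => H ⊓ Finsupp.supported R R (Set.Iic i)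
  let I : ι → Ideal R := fun i => (K i).map (Finsupp.lapply i)
  let d : ι → R := fun i => Submodule.IsPrincipal.generator (I i)
  have hd : ∀ i, ∃ x ∈ K i, x i = d i := fun i =>
    Submodule.mem_map.1 (Submodule.IsPrincipal.generator_mem (I i))
  choose h hK hdi using hd
  let J : Set ι := {i | d i ≠ 0}
  let v : J → H := fun i => ⟨h i, (hK i).1⟩
  have hzero : ∀ i k, i < k → h i k = 0 := fun i k hik => by
    by_contra hne
    exact absurd ((hK i).2 (Finsupp.mem_support_iff.2 hne)) (not_le.2 hik)
  have li : LinearIndependent R v := by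
    suffices hli : LinearIndependent R (fun i : J => h i) from
      LinearIndependent.of_comp H.subtype hli
    rw [linearIndependent_iff]
    intro c hc
    by_contra hne
    obtain ⟨j, hj, hmax⟩ := c.support.exists_max_image id (Finsupp.support_nonempty_iff.2 hne)
    have h1 : (∑ i ∈ c.support, c i • h i) j = 0 := by
      rw [Finsupp.linearCombination_apply, Finsupp.sum] at hc
      rw [hc, Finsupp.zero_apply]
    rw [Finsupp.finsetSum_apply, Finset.sum_eq_single j] at h1
    · rw [Finsupp.smul_apply, hdi, smul_eq_mul] at h1
      exact (mul_ne_zero (Finsupp.mem_support_iff.1 hj) j.2) h1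
    · intro i hi hij
      rw [Finsupp.smul_apply, hzero i j (lt_of_le_of_ne (hmax i hi) fun e => hij (Subtype.ext e)),
        smul_zero]
    · exact fun hj' => absurd hj hj'
  have sp : ∀ (i : ι) (x : H), (x : ι →₀ R) ∈ Finsupp.supported R R (Set.Iic i) →
      x ∈ Submodule.span R (Set.range v) := by
    intro i
    induction i using WellFoundedLT.induction with
    | ind i ih =>
      -- If the coefficient at `i` vanishes, the largest support index is below `i` and induction
      -- applies; otherwise a multiple of the basis vector at `i` is subtracted first.
      have below : ∀ x : H, (x : ι →₀ R) ∈ Finsupp.supported R R (Set.Iic i) →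
          (x : ι →₀ R) i = 0 → x ∈ Submodule.span R (Set.range v) := by
        intro x hx hxi
        by_cases hx0 : (x : ι →₀ R) = 0
        · rw [show x = 0 from Subtype.ext hx0]
          exact Submodule.zero_mem _
        · obtain ⟨k, hk, hmax⟩ := (x : ι →₀ R).support.exists_max_image id
            (Finsupp.support_nonempty_iff.2 hx0)
          have hki : k < i := lt_of_le_of_ne (hx hk) fun e =>
            Finsupp.mem_support_iff.1 hk (e ▸ hxi)
          exact ih k hki x fun l hl => hmax l hl
      intro x hx
      have hxI : (x : ι →₀ R) i ∈ I i := ⟨x, ⟨x.2, hx⟩, rfl⟩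
      obtain ⟨c, hc⟩ := (Submodule.IsPrincipal.mem_iff_eq_smul_generator (I i)).1 hxI
      by_cases hi : d i = 0
      · refine below x hx ?_
        rw [hc]
        change c • d i = 0
        rw [hi, smul_zero]
      · have hmem := below (x - c • v ⟨i, hi⟩) ?_ ?_
        · have e : x - c • v ⟨i, hi⟩ + c • v ⟨i, hi⟩ = x :=
            Subtype.ext (sub_add_cancel (x : ι →₀ R) (c • h i))
          rw [← e]
          exact Submodule.add_mem _ hmem (Submodule.smul_mem _ c
            (Submodule.subset_span (Set.mem_range_self (⟨i, hi⟩ : J))))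
        · exact Submodule.sub_mem _ hx (Submodule.smul_mem _ c (hK i).2)
        · change (x : ι →₀ R) i - c • h i i = 0
          rw [hdi, hc, sub_self]
  refine Module.Free.of_basis (Module.Basis.mk li fun x _ => ?_)
  by_cases hx0 : (x : ι →₀ R) = 0
  · rw [show x = 0 from Subtype.ext hx0]
    exact Submodule.zero_mem _
  · obtain ⟨k, hk, hmax⟩ := (x : ι →₀ R).support.exists_max_image id
      (Finsupp.support_nonempty_iff.2 hx0)
    exact sp k x fun l hl => hmax l hl

end Free

/-! ### The centre is free abelian -/

namespace Gam

theorem commute_of_central {g : Gam} (hg : g ∈ Subgroup.center Gam) (h : Gam) : h * g = g * h :=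
  Subgroup.mem_center_iff.1 hg h

/-- An odd shift would exchange the sections of the letter (1, 0, 0, 0), whose shifts are 1 and 0.
-/
theorem shift_even_of_central {g : Gam} (hg : g ∈ Subgroup.center Gam) :
    ((shift g : ℤ) : ZMod 2) = 0 := by
  have h01 : ∀ j : ZMod 2, j = 0 ∨ j = 1 := by decide
  refine (h01 _).resolve_right fun h => ?_
  have h1 := congrArg (fun x => shift (sec 0 x)) (commute_of_central hg (dir (1, 0, 0, 0)))
  simp [h, Letter.spin] at h1

theorem sec_eq_of_central {g : Gam} (hg : g ∈ Subgroup.center Gam) : sec 0 g = sec 1 g := by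
  have h1 := congrArg (sec 0) (commute_of_central hg (rot 1))
  simpa using h1.symm

/-- Every element is the section of an element that fixes the first level. -/
theorem exists_sec_one_eq (h : Gam) : ∃ g, shift g = 0 ∧ sec 1 g = h := by
  induction h using induction with
  | hr i => exact ⟨tw 1 (i, 0, 0, 0), by simp, by simp [sec_tw, Letter.spin]⟩
  | hd β =>
    -- The witness is the preimage of β under `turn`.
    refine ⟨dir (β.2.1 - β.1, -β.1, β.2.2.1, β.2.2.2), by simp, ?_⟩
    simp [Letter.turn]
  | hm g h hg hh =>
    obtain ⟨g', hg0, rfl⟩ := hg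
    obtain ⟨h', hh0, rfl⟩ := hh
    exact ⟨g' * h', by simp [hg0, hh0], by simp [hg0]⟩

theorem sec_one_mem_center {g : Gam} (hg : g ∈ Subgroup.center Gam) :
    sec 1 g ∈ Subgroup.center Gam := by
  rw [Subgroup.mem_center_iff]
  intro h
  obtain ⟨h', h0, rfl⟩ := exists_sec_one_eq h
  have h1 := congrArg (sec 1) (commute_of_central hg h')
  simpa [h0, shift_even_of_central hg] using h1

instance : CommGroup (Subgroup.center Gam) :=
  { (inferInstance : Group (Subgroup.center Gam)) with
    mul_comm := fun x y => Subtype.ext (commute_of_central y.2 x.1) }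

/-- The centre, written additively. -/
abbrev Center : Type := Additive (Subgroup.center Gam)

/-- The element of the group underlying a central element. -/
def Center.val (x : Center) : Gam := x.toMul.1

theorem Center.val_mem (x : Center) : x.val ∈ Subgroup.center Gam := x.toMul.2

theorem Center.ext {x y : Center} (h : x.val = y.val) : x = y := Subtype.ext h

@[simp] theorem Center.val_add (x y : Center) : (x + y).val = x.val * y.val := rfl
@[simp] theorem Center.val_zero : (0 : Center).val = 1 := rfl

/-- Taking sections is an endomorphism of the centre. -/
def Center.down : Module.End ℤ Center := AddMonoidHom.toIntLinearMap
  { toFun := fun x => Additive.ofMul ⟨sec 1 x.val, sec_one_mem_center x.val_mem⟩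
    map_zero' := rfl
    map_add' := fun x y => Center.ext <| by
      change sec 1 (x.val * y.val) = sec 1 x.val * sec 1 y.val
      simp [shift_even_of_central x.val_mem] }

namespace Center

theorem val_down (x : Center) : (down x).val = sec 1 x.val := rfl

/-- Rooted elements have trivial sections. In the case of one letter, one of the two equal sections
is rooted, so two steps suffice. -/
theorem exists_down_pow_eq_zero (x : Center) : ∃ n : ℕ, (down ^ n) x = 0 := by
  suffices h : ∀ g : Gam, ∀ x : Center, x.val = g → ∃ n : ℕ, (down ^ n) x = 0 from h _ x rfl
  have hrot : ∀ x : Center, ∀ i, x.val = rot i → down x = 0 := fun x i hx =>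
    Center.ext (by simp [val_down, hx])
  refine section_induction ?_ ?_ ?_
  · intro i x hx
    exact ⟨1, by rw [pow_one, hrot x i hx]⟩
  · intro i ε β x hx
    refine ⟨2, ?_⟩
    have hi := shift_even_of_central x.val_mem
    have h01 := sec_eq_of_central x.val_mem
    simp only [hx, shift_mul, shift_rot, shift_tw, add_zero] at hi
    have h : sec 1 x.val = rot β.spin := by
      have hε : ∀ j : ZMod 2, 0 = j ∨ 1 = j := by decide
      rcases hε ε with rfl | rfl
      · rw [← h01, hx]
        simp [hi, sec_tw]
      · rw [hx]
        simp [hi, sec_tw]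
    rw [pow_two]
    exact hrot _ _ h
  · intro g ih x hx
    obtain ⟨n, hn⟩ := ih 1 (down x) (by rw [val_down, hx])
    exact ⟨n + 1, by rw [pow_succ]; exact hn⟩

/-- The two sections coincide, so each charge is twice that of `down x`, and it is 0 after finitely
many steps. -/
theorem charge_val (x : Center) : charge x.val = 0 ∧ cocharge x.val = 0 := by
  obtain ⟨n, hn⟩ := exists_down_pow_eq_zero x
  induction n generalizing x with
  | zero =>
    have : x = 0 := hn
    simp [this]
  | succ n ih =>
    rw [pow_succ] at hn
    have h := ih (down x) hn
    rw [val_down] at h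
    rw [charge_eq, cocharge_eq, sec_eq_of_central x.val_mem, h.1, h.2]
    simp

theorem charge_sec (x : Center) (j : ZMod 2) :
    charge (sec j x.val) = 0 ∧ cocharge (sec j x.val) = 0 := by
  have h := charge_val (down x)
  rw [val_down] at h
  have h01 : ∀ j : ZMod 2, j = 0 ∨ j = 1 := by decide
  rcases h01 j with rfl | rfl
  · rwa [sec_eq_of_central x.val_mem]
  · exact h

/-- The shift and the area as a linear map. -/
def data (b : Bool) : Center →ₗ[ℤ] ℤ := AddMonoidHom.toIntLinearMap
  { toFun := fun x => if b then shift x.val else area x.val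
    map_zero' := by simp
    map_add' := fun x y => by
      cases b
      -- The cocycle term is a multiple of charges of sections of x, which vanish.
      · simp [area_mul, (charge_sec x _).1]
      · simp }

theorem eq_zero_of_data {x : Center} (h : down x = 0) (hd : ∀ b, data b x = 0) : x = 0 := by
  have h1 : sec 1 x.val = 1 := congrArg val h
  have h01 : ∀ j : ZMod 2, j = 0 ∨ j = 1 := by decide
  refine Center.ext (Gam.ext (hd true) (hd false) fun j => ?_)
  rcases h01 j with rfl | rfl
  · rw [sec_eq_of_central x.val_mem, h1]; rfl
  · rw [h1]; rfl

theorem down_pow_eq_zero_of_le {x : Center} {m n : ℕ} (hmn : m ≤ n) (h : (down ^ m) x = 0) :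
    (down ^ n) x = 0 := by
  obtain ⟨k, rfl⟩ := Nat.exists_eq_add_of_le' hmn
  rw [pow_add, Module.End.mul_apply, h, map_zero]

theorem finite_support (x : Center) :
    (Function.support fun i : ℕ × Bool => data i.2 ((down ^ i.1) x)).Finite := by
  obtain ⟨n, hn⟩ := exists_down_pow_eq_zero x
  refine ((Set.finite_lt_nat n).prod (Set.finite_univ (α := Bool))).subset fun i hi => ?_
  refine ⟨?_, trivial⟩
  by_contra hlt
  refine hi ?_
  simp only [down_pow_eq_zero_of_le (not_lt.1 hlt) hn, map_zero]

/-- The data at all levels. -/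
noncomputable def allData : Center →ₗ[ℤ] (ℕ × Bool →₀ ℤ) := AddMonoidHom.toIntLinearMap
  { toFun := fun x => Finsupp.ofSupportFinite _ (finite_support x)
    map_zero' := by ext; simp [Finsupp.ofSupportFinite_coe]
    map_add' := fun x y => by ext; simp [Finsupp.ofSupportFinite_coe] }

theorem allData_apply (x : Center) (i : ℕ × Bool) :
    allData x i = data i.2 ((down ^ i.1) x) := rfl

theorem allData_injective : Function.Injective allData := by
  rw [injective_iff_map_eq_zero]
  intro x hx
  obtain ⟨n, hn⟩ := exists_down_pow_eq_zero x
  have hd : ∀ k b, data b ((down ^ k) x) = 0 := fun k b => by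
    rw [← allData_apply x (k, b), hx, Finsupp.zero_apply]
  induction n with
  | zero => exact hn
  | succ n ih =>
    refine ih (eq_zero_of_data ?_ (hd n))
    rw [← Module.End.mul_apply, ← pow_succ']
    exact hn

instance : Module.Free ℤ Center := by
  obtain ⟨_, _⟩ := exists_wellFoundedLT (ℕ × Bool)
  have := free_submodule_finsupp (LinearMap.range allData)
  exact Module.Free.of_equiv (LinearEquiv.ofInjective allData allData_injective).symm

end Center

/-- The sections commute with everything, and their vanishing charges kill the cocycle terms on both
sides. -/
theorem mem_center_of_sections {g : Gam} (x : Center) (h : shift g = 0)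
    (hx : ∀ j, sec j g = x.val) : g ∈ Subgroup.center Gam := by
  rw [Subgroup.mem_center_iff]
  intro k
  have hc := x.charge_val
  refine ext (by simp [add_comm]) ?_ fun j => ?_
  · simp [area_mul, hx, hc.1, hc.2, add_comm]
  · simp [h, hx, commute_of_central x.val_mem]

/-! ### Infinite rank of the centre -/

/-- The subgroup of lamp configurations. -/
def lamps : Subgroup Gam := Subgroup.normalClosure {dir (0, 0, 1, 0), dir (0, 0, 0, 1)}

instance : lamps.Normal := Subgroup.normalClosure_normal

/-- The liftable elements form a normal subgroup, as conjugators lift by `exists_sec_one_eq`, and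
both lamps lift to themselves. This is why the central elements below are kept inside `lamps`. -/
theorem exists_lamps_sec {h : Gam} (hh : h ∈ lamps) :
    ∃ g ∈ lamps, shift g = 0 ∧ sec 0 g = 1 ∧ sec 1 g = h := by
  let M : Subgroup Gam :=
    { carrier := {h | ∃ g ∈ lamps, shift g = 0 ∧ sec 0 g = 1 ∧ sec 1 g = h}
      one_mem' := ⟨1, lamps.one_mem, by simp⟩
      mul_mem' := by
        rintro _ _ ⟨g, hg, h1, h2, rfl⟩ ⟨g', hg', h1', h2', rfl⟩
        exact ⟨g * g', lamps.mul_mem hg hg', by simp [h1, h1', h2, h2']⟩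
      inv_mem' := by
        rintro _ ⟨g, hg, h1, h2, rfl⟩
        exact ⟨g⁻¹, lamps.inv_mem hg, by simp [h1, h2]⟩ }
  have : M.Normal := by
    refine ⟨?_⟩
    rintro _ ⟨g, hg, h1, h2, rfl⟩ k
    obtain ⟨k', hk, rfl⟩ := exists_sec_one_eq k
    exact ⟨k' * g * k'⁻¹, Subgroup.Normal.conj_mem inferInstance g hg k', by simp [h1, h2, hk]⟩
  have hM : lamps ≤ M := by
    refine Subgroup.normalClosure_le_normal ?_
    rintro _ (rfl | rfl)
    · exact ⟨_, Subgroup.subset_normalClosure (Or.inl rfl), by simp [Letter.spin, Letter.turn]⟩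
    · exact ⟨_, Subgroup.subset_normalClosure (Or.inr rfl), by simp [Letter.spin, Letter.turn]⟩
  exact hM hh

-- Two lamps of different kinds in different subtrees have commuting sections but a nontrivial area
-- commutator. A lift of x with sections 1 and x, times its conjugate by the rotation, has both
-- sections x, so `down` sends it to x.
open scoped commutatorElement in
theorem Center.exists_lamps_down_pow (n : ℕ) : ∃ x : Center, x.val ∈ lamps ∧ (down ^ n) x ≠ 0 := by
  have h11 : (1 + 1 : ZMod 2) = 0 := rfl
  induction n with
  | zero =>
    let e := dir (0, 0, 1, 0)
    let f := tw 1 (0, 0, 0, 1)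
    have hs : ∀ j, sec j ⁅e, f⁆ = (0 : Center).val := by
      have h01 : ∀ j : ZMod 2, j = 0 ∨ j = 1 := by decide
      intro j
      rcases h01 j with rfl | rfl <;>
        simp [e, f, commutatorElement_def, sec_tw, Letter.spin]
    have hc : ⁅e, f⁆ ∈ Subgroup.center Gam :=
      mem_center_of_sections 0 (by simp [commutatorElement_def]) hs
    refine ⟨Additive.ofMul ⟨⁅e, f⁆, hc⟩, ?_, fun h => ?_⟩
    · have he : e ∈ lamps := Subgroup.subset_normalClosure (Or.inl rfl)
      change e * f * e⁻¹ * f⁻¹ ∈ lamps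
      rw [mul_assoc, mul_assoc]
      refine lamps.mul_mem he ?_
      rw [← mul_assoc]
      exact Subgroup.Normal.conj_mem inferInstance _ (lamps.inv_mem he) f
    · have h1 : ⁅e, f⁆ = 1 := congrArg val h
      have h2 := congrArg area (commutatorElement_eq_one_iff_mul_comm.1 h1)
      simp [area_mul, e, f, sec_tw, Letter.spin, Letter.turn] at h2
  | succ n ih =>
    obtain ⟨x, hx, hn⟩ := ih
    obtain ⟨g, hg, h1, h2, h3⟩ := exists_lamps_sec hx
    have hc : g * (rot 1 * g * (rot 1)⁻¹) ∈ Subgroup.center Gam := by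
      refine mem_center_of_sections x (by simp [h1]) fun j => ?_
      have h01 : ∀ j : ZMod 2, j = 0 ∨ j = 1 := by decide
      rcases h01 j with rfl | rfl <;> simp [h1, h2, h3, h11]
    refine ⟨Additive.ofMul ⟨_, hc⟩, ?_, ?_⟩
    · exact lamps.mul_mem hg (Subgroup.Normal.conj_mem inferInstance _ hg _)
    · rw [pow_succ, Module.End.mul_apply]
      convert hn
      refine Center.ext ?_
      change sec 1 (g * (rot 1 * g * (rot 1)⁻¹)) = x.val
      simp [h1, h2, h3, h11]

instance : Countable Gam := by
  refine Function.Surjective.countable (f := fun x : ℤ × Word => rot x.1 * eval x.2) fun g => ?_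
  obtain ⟨L, hL⟩ := exists_eval g
  exact ⟨(shift g, L), hL.symm⟩

/-- On a finite basis a single power of `down` would vanish. -/
theorem Center.exists_basis : Nonempty (Module.Basis ℕ ℤ Center) := by
  let b := Module.Free.chooseBasis ℤ Center
  have : Countable Center := inferInstanceAs (Countable (Subgroup.center Gam))
  have : Countable (Module.Free.ChooseBasisIndex ℤ Center) := b.injective.countable
  have : Infinite (Module.Free.ChooseBasisIndex ℤ Center) := by
    by_contra hfin
    rw [not_infinite_iff_finite] at hfin
    cases nonempty_fintype (Module.Free.ChooseBasisIndex ℤ Center)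
    choose n hn using fun i => exists_down_pow_eq_zero (b i)
    obtain ⟨x, -, hx⟩ := exists_lamps_down_pow (∑ i, n i)
    refine hx ?_
    have h0 : (down ^ ∑ i, n i : Module.End ℤ Center) = 0 := b.ext fun i =>
      down_pow_eq_zero_of_le (Finset.single_le_sum (fun _ _ => Nat.zero_le _) (Finset.mem_univ i))
        (hn i)
    rw [h0, LinearMap.zero_apply]
  obtain ⟨e⟩ := nonempty_equiv_of_countable (α := Module.Free.ChooseBasisIndex ℤ Center) (β := ℕ)
  exact ⟨b.reindex e⟩

end Gam

/-! ### Growth is not polynomial; conclusion -/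

open SimpleGraph in
/-- A group containing free abelian subgroups of all finite ranks does not have polynomial
growth. -/
theorem not_polynomiallyBounded {G A : Type*} [Group G] [AddCommGroup A] {S : Finset G}
    (hS : Subgroup.closure (S : Set G) = ⊤)
    (hfin : ∀ n : ℕ, {g : G | (mulCayley (S : Set G)).edist 1 g ≤ (n : ℕ∞)}.Finite)
    (F : Multiplicative A →* G) (hF : Function.Injective F) {u : ℕ → A}
    (hu : LinearIndependent ℤ u) : ¬ PolynomiallyBounded (growthFunction S) := by
  classical
  rintro ⟨d, hd, C, hC, hv⟩
  let e : A → ℕ∞ := fun a => (mulCayley (S : Set G)).edist 1 (F (.ofAdd a))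
  have he0 : e 0 = 0 := by simp [e]
  have head : ∀ a b, e (a + b) ≤ e a + e b := fun a b => by
    simp only [e, ofAdd_add, map_mul]
    exact edist_one_mul_le _ _ _
  have hsmul : ∀ (a : A) (n : ℕ), e (n • a) ≤ n * e a := by
    intro a n
    induction n with
    | zero => simp [he0]
    | succ n ih =>
      rw [succ_nsmul, Nat.cast_add, Nat.cast_one, add_mul, one_mul]
      exact (head _ _).trans (add_le_add ih le_rfl)
  have hsum : ∀ (s : Finset ℕ) (x : ℕ → A), e (∑ i ∈ s, x i) ≤ ∑ i ∈ s, e (x i) := by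
    intro s x
    induction s using Finset.induction_on with
    | empty => simp [he0]
    | insert i s hi ih =>
      rw [Finset.sum_insert hi, Finset.sum_insert hi]
      exact (head _ _).trans (add_le_add le_rfl ih)
  have hlen : ∀ i, ∃ l : ℕ, e (u i) = l := fun i =>
    ⟨_, (ENat.natCast_toNat (edist_one_ne_top hS (F (.ofAdd (u i))))).symm⟩
  choose l hl using hlen
  -- A box of side n in rank D ≥ d + 1 fits into a ball of radius n * ℓ, so a polynomial bound of
  -- degree d would bound n itself.
  let D : ℕ := ⌈d⌉₊ + 1
  let ℓ : ℕ := ∑ i ∈ Finset.range D, l i + 1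
  have hcard : ∀ n : ℕ, (n + 1) ^ D ≤ growthFunction S (n * ℓ) := by
    intro n
    let f : (Fin D → Fin (n + 1)) → G := fun x => F (.ofAdd (∑ i, (x i : ℕ) • u i))
    have hf : Function.Injective f := by
      intro x y hxy
      have h1 : ∑ i, (x i : ℕ) • u i = ∑ i, (y i : ℕ) • u i := hF hxy
      have h2 := hu.comp (fun i : Fin D => (i : ℕ)) Fin.val_injective
      rw [Fintype.linearIndependent_iff] at h2
      have h3 := h2 (fun i => ((x i : ℕ) : ℤ) - ((y i : ℕ) : ℤ)) (by
        simp only [sub_smul, Function.comp, natCast_zsmul, Finset.sum_sub_distrib]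
        rw [h1, sub_self])
      funext i
      have := h3 i
      apply Fin.ext
      omega
    have hsub : Set.range f ⊆ {g : G | (mulCayley (S : Set G)).edist 1 g ≤ ((n * ℓ : ℕ) : ℕ∞)} := by
      rintro _ ⟨x, rfl⟩
      have h1 : ∑ i, (x i : ℕ) • u i = ∑ i ∈ Finset.range D,
          (if h : i < D then (x ⟨i, h⟩ : ℕ) else 0) • u i := by
        rw [Finset.sum_range]
        simp
      have h2 : e (∑ i, (x i : ℕ) • u i) ≤ ((∑ i ∈ Finset.range D, n * l i : ℕ) : ℕ∞) := by
        rw [h1, Nat.cast_sum]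
        refine (hsum _ _).trans (Finset.sum_le_sum fun i hi => (hsmul _ _).trans ?_)
        rw [hl, Nat.cast_mul]
        refine mul_le_mul_left ?_ _
        rw [dif_pos (Finset.mem_range.1 hi)]
        exact_mod_cast Nat.lt_succ_iff.1 (x _).2
      refine le_trans h2 (Nat.cast_le.2 ?_)
      rw [← Finset.mul_sum]
      exact Nat.mul_le_mul_left n (Nat.le_succ _)
    have h4 := Set.ncard_le_ncard hsub (hfin _)
    rw [← Set.image_univ, Set.ncard_image_of_injective _ hf, Set.ncard_univ,
      Nat.card_eq_fintype_card,
      Fintype.card_fun, Fintype.card_fin, Fintype.card_fin] at h4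
    exact h4
  have hbound : ∀ n : ℕ, 1 ≤ n → (n : ℝ) ≤ C * (ℓ : ℝ) ^ d := by
    intro n hn
    have hn1 : (1 : ℝ) ≤ n := by exact_mod_cast hn
    have hn0 : (0 : ℝ) < n := by linarith
    have hl1 : 1 ≤ ℓ := Nat.succ_le_succ (Nat.zero_le _)
    have h1 := hv (n * ℓ) (Nat.mul_pos hn hl1)
    have h2 : ((n : ℝ)) ^ D ≤ growthFunction S (n * ℓ) := by
      have : n ^ D ≤ growthFunction S (n * ℓ) :=
        (Nat.pow_le_pow_left (Nat.le_succ n) D).trans (hcard n)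
      exact_mod_cast this
    have h3 : (n : ℝ) * (n : ℝ) ^ d ≤ (n : ℝ) ^ D := by
      rw [← Real.rpow_natCast, ← Real.rpow_one_add' hn0.le (by linarith)]
      refine Real.rpow_le_rpow_of_exponent_le hn1 ?_
      have := Nat.le_ceil d
      simp only [D, Nat.cast_add, Nat.cast_one]
      linarith
    have h4 : (n : ℝ) * (n : ℝ) ^ d ≤ C * (ℓ : ℝ) ^ d * (n : ℝ) ^ d := by
      refine h3.trans (h2.trans (h1.trans (le_of_eq ?_)))
      rw [Nat.cast_mul, Real.mul_rpow hn0.le (Nat.cast_nonneg _)]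
      ring
    exact le_of_mul_le_mul_right h4 (Real.rpow_pos_of_pos hn0 d)
  obtain ⟨n, hn⟩ := exists_nat_gt (C * (ℓ : ℝ) ^ d)
  have h0 : (0 : ℝ) ≤ C * (ℓ : ℝ) ^ d := by positivity
  have hn1 : 1 ≤ n := by
    have : (0 : ℝ) < n := lt_of_le_of_lt h0 hn
    exact_mod_cast this
  exact absurd (hbound n hn1) (not_le.2 hn)

theorem Gam.intermediateGrowth : IntermediateGrowth Gam := by
  refine ⟨Gam.fg, fun S hS => ⟨Gam.subexponential S, ?_⟩⟩
  obtain ⟨b⟩ := Gam.Center.exists_basis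
  let F : Multiplicative Gam.Center →* Gam :=
    (Subgroup.center Gam).subtype.comp (AddEquiv.toMultiplicativeLeft (AddEquiv.refl _)).toMonoidHom
  exact not_polynomiallyBounded hS (Gam.ball_finite S) F
    (fun x y h => Subtype.ext h) b.linearIndependent

theorem Gam.center_equiv :
    Nonempty (Subgroup.center Gam ≃* Multiplicative (DirectSum ℕ fun _ : ℕ => ℤ)) := by
  classical
  obtain ⟨b⟩ := Gam.Center.exists_basis
  let e : Gam.Center ≃+ DirectSum ℕ fun _ : ℕ => ℤ :=
    (b.repr.trans (finsuppLEquivDirectSum ℤ ℤ ℕ)).toAddEquiv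
  exact ⟨AddEquiv.toMultiplicativeRight e⟩

end IntermediateCenter

theorem mainTheorem4 :
    ∃ (Γ : Type) (_ : Group Γ),
      Group.FG Γ ∧ TorsionFreeGroup Γ ∧ IntermediateGrowth Γ ∧
        Nonempty (Subgroup.center Γ ≃* Multiplicative (DirectSum ℕ fun _ : ℕ => ℤ)) :=
  ⟨IntermediateCenter.Gam, inferInstance, IntermediateCenter.Gam.fg,
    IntermediateCenter.Gam.torsionFree, IntermediateCenter.Gam.intermediateGrowth,
    IntermediateCenter.Gam.center_equiv⟩
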